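/- Let $W=(W(t))_{t\in\mathbb R}$ be a standard Brownian motion on the real line, defined on a probability space $(\Omega,\mathcal F,P)$, let $\alpha,\sigma>0$, and let $X$ be the stationary Ornstein–Uhlenbeck process, that is, a version with almost surely continuous paths of $$X(t)=\sqrt{2\alpha}\,\sigma\int_{-\infty}^t e^{-\alpha(t-s)}\,dW(s),\qquad t\in\mathbb R$$ (Wiener integral); such a version exists. Definitions. Let $E$ be a Banach space. A continuous $f:\mathbb R\to E$ is *almost automorphic* if every real sequence $(t'_n)$ has a subsequence $(t_n)$ for which, for all $t$, $g(t)=\lim_n f(t+t_n)$ exists and $\lim_n g(t-t_n)=f(t)$. Let $\mu$ be a Borel measure on $\mathbb R$ such that $$(\mathrm{mu})\quad \mu(\mathbb R)=\infty\ \text{ and }\ \mu(I)<\infty\text{ for every bounded interval } I,\qquad\qquad (\mathrm{R+})\quad \liminf_{r\to\infty}\frac{\mu([0,r])}{\mu([-r,r])}>0 .$$ The function $f$ is *$\mu$-pseudo almost automorphic* if $f=g+\Phi$ with $g$ almost automorphic and $\Phi$ bounded, continuous, with $\frac1{\mu([-r,r])}\int_{[-r,r]}\|\Phi(t)\|\,d\mu(t)\to0$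 as $r\to\infty$. A process with finite second moments has one of these properties *in square mean* if $t\mapsto X(t)\in L^2(\Omega,P)$ has it. Given seminorms $|h|(t)$ ($t\in\mathbb R$) and $\|h\|$, the corresponding *-like $\mu$-pseudo almost automorphic* functions are the sums $g+\Phi$, where $g,\Phi$ are locally square integrable, $\|g\|,\|\Phi\|<\infty$, every real sequence $(t'_n)$ has a subsequence $(t_n)$ for which there is a locally square integrable $k$ such that, for all $t$, $|g(\cdot+t_n)-k|(t)\to0$ and $|k(\cdot-t_n)-g|(t)\to0$, and $\frac1{\mu([-r,r])}\int_{[-r,r]}|\Phi|(t)\,d\mu(t)\to0$. The seminorms are * Stepanov with weight $\nu$, a Borel measure on $[0,1]$ with $0<\nu([0,1])<\infty$: $|h|(t)=\big(\int_0^1\|h(t+s)\|^2d\nu(s)\big)^{1/2}$ and $\|h\|=\sup_t|h|(t)$, local square integrability meaning here that $s\mapsto h(t+s)$ is in $L^2([0,1],\nu)$ for all $t$; * Weyl: $|h|(x)=\limsup_{r\to\infty}\big(\frac1{2r}\int_{x-r}^{x+r}\|h(t)\|^2dt\big)^{1/2}$ and $\|h\|=\lim_{r\to\infty}\sup_x\big(\frac1{2r}\int_{x-r}^{x+r}\|h(t)\|^2dt\big)^{1/2}$;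 * Besicovitch: $|h|(x)=\|h\|=\limsup_{r\to\infty}\big(\frac1{2r}\int_{-r}^{r}\|h(t)\|^2dt\big)^{1/2}$ for all $x$. Then the following hold. 1. $X$ is a Gaussian process with mean $0$ and $\operatorname{Cov}(X(t),X(t+\tau))=\sigma^2e^{-\alpha\tau}$ for all $t\in\mathbb R$, $\tau\ge0$. 2. $X$ is an $L^2$-bounded solution on $\mathbb R$, non-anticipating with respect to the increments of $W$, of $$dX(t)=-\alpha X(t)\,dt+\sqrt{2\alpha}\,\sigma\,dW(t),$$ and every $L^2$-bounded solution (a process with almost surely continuous paths which satisfies the integrated equation between any two times, almost surely) is indistinguishable from $X$. 3. $X$ is not square-mean $\mu$-pseudo almost automorphic for any $\mu$ satisfying (mu) and (R+). 4. $X$ is neither Besicovitch-like nor Weyl-like square-mean $\mu$-pseudo almost automorphic, for any $\mu$ satisfying (mu), in particular for the Lebesgue measure. 5. $X$ is not square-mean Stepanov-like ($\mathbb S^2_\nu$-)$\mu$-pseudo almost automorphic, for any $\mu$ satisfying (mu) and (R+) and any Borel measure $\nu$ on $[0,1]$ with $0<\nu([0,1])<\infty$. 6. Consequently, the equation in 2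 has no square-mean almost automorphic solution, and no square-mean $\mu$-pseudo almost automorphic solution for any $\mu$ satisfying (mu) and (R+). -/

import Mathlib

open MeasureTheory ProbabilityTheory Filter Topology Set
open scoped ENNReal NNReal

noncomputable section

namespace AlmostAutomorphy

/-! ### Almost automorphic, `μ`-ergodic and `μ`-pseudo almost automorphic functions -/

/-- Almost automorphic functions `ℝ → E`. -/
def IsAlmostAutomorphic {E : Type*} [TopologicalSpace E] (f : ℝ → E) : Prop :=
  Continuous f ∧ ∀ t' : ℕ → ℝ, ∃ φ : ℕ → ℕ, StrictMono φ ∧ ∃ g : ℝ → E, ∀ t : ℝ,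
    Tendsto (fun n => f (t + t' (φ n))) atTop (𝓝 (g t)) ∧
    Tendsto (fun n => g (t - t' (φ n))) atTop (𝓝 (f t))

/-- The condition `μ(ℝ) = ∞` and `μ(I) < ∞` for every bounded interval `I`. -/
def IsAdmissibleWeight (μ : Measure ℝ) : Prop :=
  μ univ = ∞ ∧ ∀ a b : ℝ, μ (Icc a b) < ∞

/-- The condition `liminf_{r → ∞} μ([0, r]) / μ([-r, r]) > 0`. -/
def HasPositiveRightWeight (μ : Measure ℝ) : Prop :=
  0 < liminf (fun r : ℝ => μ (Icc 0 r) / μ (Icc (-r) r)) atTop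

/-- Bounded continuous functions whose norm has `μ`-mean zero. -/
def IsErgodic {E : Type*} [NormedAddCommGroup E] (μ : Measure ℝ) (f : ℝ → E) : Prop :=
  Continuous f ∧ (∃ C : ℝ, ∀ t, ‖f t‖ ≤ C) ∧
    Tendsto (fun r : ℝ => (μ.real (Icc (-r) r))⁻¹ * ∫ t in Icc (-r) r, ‖f t‖ ∂μ) atTop (𝓝 0)

/-- `μ`-pseudo almost automorphic functions. -/
def IsPseudoAlmostAutomorphic {E : Type*} [NormedAddCommGroup E] (μ : Measure ℝ) (f : ℝ → E) :
    Prop :=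
  ∃ g Φ : ℝ → E, IsAlmostAutomorphic g ∧ IsErgodic μ Φ ∧ ∀ t, f t = g t + Φ t

/-! ### Variants of almost automorphy attached to seminorms

All the variants follow the same scheme. The data are a class `L` of functions, a family of local
seminorms `N h t` (`h ∈ L`, `t ∈ ℝ`) and a global seminorm `B h`. -/

/-- Almost automorphy with respect to the local seminorms `N` and the global seminorm `B`. -/
def IsAlmostAutomorphicFor {E : Type*} [NormedAddCommGroup E] (L : (ℝ → E) → Prop)
    (N : (ℝ → E) → ℝ → ℝ≥0∞) (B : (ℝ → E) → ℝ≥0∞) (f : ℝ → E) : Prop :=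
  L f ∧ B f < ∞ ∧ ∀ t' : ℕ → ℝ, ∃ φ : ℕ → ℕ, StrictMono φ ∧ ∃ g : ℝ → E, L g ∧ ∀ t : ℝ,
    Tendsto (fun n => N (fun s => f (s + t' (φ n)) - g s) t) atTop (𝓝 0) ∧
    Tendsto (fun n => N (fun s => g (s - t' (φ n)) - f s) t) atTop (𝓝 0)

/-- `μ`-ergodicity with respect to the local seminorms `N` and the global seminorm `B`. -/
def IsErgodicFor {E : Type*} [NormedAddCommGroup E] (L : (ℝ → E) → Prop)
    (N : (ℝ → E) → ℝ → ℝ≥0∞) (B : (ℝ → E) → ℝ≥0∞) (μ : Measure ℝ) (f : ℝ → E) : Prop :=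
  L f ∧ B f < ∞ ∧ AEMeasurable (N f) μ ∧
    Tendsto (fun r : ℝ => (μ (Icc (-r) r))⁻¹ * ∫⁻ t in Icc (-r) r, N f t ∂μ) atTop (𝓝 0)

/-- `μ`-pseudo almost automorphy with respect to the local seminorms `N` and the global
seminorm `B`. -/
def IsPseudoAlmostAutomorphicFor {E : Type*} [NormedAddCommGroup E] (L : (ℝ → E) → Prop)
    (N : (ℝ → E) → ℝ → ℝ≥0∞) (B : (ℝ → E) → ℝ≥0∞) (μ : Measure ℝ) (f : ℝ → E) : Prop :=
  ∃ g Φ : ℝ → E, IsAlmostAutomorphicFor L N B g ∧ IsErgodicFor L N B μ Φ ∧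
    ∀ t, f t = g t + Φ t

/-- Locally `p`-integrable functions. -/
def LocallyPIntegrable {E : Type*} [NormedAddCommGroup E] (p : ℝ) (h : ℝ → E) : Prop :=
  ∀ a b : ℝ, MemLp h (ENNReal.ofReal p) (volume.restrict (Icc a b))

/-- Functions all of whose translates are `p`-integrable on `[0, 1]` with respect to `ν`; for the
Lebesgue measure `ν` these are the locally `p`-integrable functions. -/
def LocallyPIntegrableWith {E : Type*} [NormedAddCommGroup E] (p : ℝ)
    (ν : Measure (Icc (0 : ℝ) 1)) (h : ℝ → E) : Prop :=
  ∀ t : ℝ, MemLp (fun s : Icc (0 : ℝ) 1 => h (t + (s : ℝ))) (ENNReal.ofReal p) ν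

/-- The weighted Stepanov seminorm `(∫_{[0,1]} ‖h(t + s)‖ᵖ dν(s))^{1/p}`. -/
def stepanovAt {E : Type*} [NormedAddCommGroup E] (p : ℝ) (ν : Measure (Icc (0 : ℝ) 1))
    (h : ℝ → E) (t : ℝ) : ℝ≥0∞ :=
  (∫⁻ s : Icc (0 : ℝ) 1, ‖h (t + (s : ℝ))‖ₑ ^ p ∂ν) ^ (1 / p)

/-- The supremum over `t` of the weighted Stepanov seminorms at `t`. -/
def stepanovNorm {E : Type*} [NormedAddCommGroup E] (p : ℝ) (ν : Measure (Icc (0 : ℝ) 1))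
    (h : ℝ → E) : ℝ≥0∞ :=
  ⨆ t : ℝ, stepanovAt p ν h t

/-- The mean `((1 / 2r) ∫_{x-r}^{x+r} ‖h(t)‖ᵖ dt)^{1/p}`. -/
def windowMean {E : Type*} [NormedAddCommGroup E] (p : ℝ) (h : ℝ → E) (x r : ℝ) : ℝ≥0∞ :=
  ((ENNReal.ofReal (2 * r))⁻¹ * ∫⁻ t in Icc (x - r) (x + r), ‖h t‖ₑ ^ p) ^ (1 / p)

/-- The local Weyl seminorm at `x`. The limit over `r` need not exist for every `h`; the upper
limit, which is the limit whenever there is one, is defined for all `h`. -/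
def weylAt {E : Type*} [NormedAddCommGroup E] (p : ℝ) (h : ℝ → E) (x : ℝ) : ℝ≥0∞ :=
  limsup (fun r : ℝ => windowMean p h x r) atTop

/-- The Weyl seminorm: the limit as `r → ∞` of the supremum over `x` of the means over
`[x - r, x + r]`. -/
def weylNorm {E : Type*} [NormedAddCommGroup E] (p : ℝ) (h : ℝ → E) : ℝ≥0∞ :=
  limsup (fun r : ℝ => ⨆ x : ℝ, windowMean p h x r) atTop

/-- The Besicovitch seminorm. -/
def besicovitchNorm {E : Type*} [NormedAddCommGroup E] (p : ℝ) (h : ℝ → E) : ℝ≥0∞ :=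
  limsup (fun r : ℝ => windowMean p h 0 r) atTop

/-- Stepanov-like (with weight `ν`) `μ`-pseudo almost automorphic functions. -/
def IsStepanovPAA {E : Type*} [NormedAddCommGroup E] (p : ℝ) (ν : Measure (Icc (0 : ℝ) 1))
    (μ : Measure ℝ) (f : ℝ → E) : Prop :=
  IsPseudoAlmostAutomorphicFor (LocallyPIntegrableWith p ν) (stepanovAt p ν) (stepanovNorm p ν) μ f

/-- Weyl-like `μ`-pseudo almost automorphic functions. -/
def IsWeylPAA {E : Type*} [NormedAddCommGroup E] (p : ℝ) (μ : Measure ℝ) (f : ℝ → E) : Prop :=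
  IsPseudoAlmostAutomorphicFor (LocallyPIntegrable p) (weylAt p) (weylNorm p) μ f

/-- Besicovitch-like `μ`-pseudo almost automorphic functions; the local seminorms are all equal
to the Besicovitch seminorm. -/
def IsBesicovitchPAA {E : Type*} [NormedAddCommGroup E] (p : ℝ) (μ : Measure ℝ) (f : ℝ → E) :
    Prop :=
  IsPseudoAlmostAutomorphicFor (LocallyPIntegrable p) (fun h _ => besicovitchNorm p h)
    (besicovitchNorm p) μ f

/-! ### Stochastic processes -/

variable {Ω : Type*} [MeasurableSpace Ω]

/-- The process `X` has finite second moments and `t ↦ X(t)`, as a map from `ℝ` to `L²(Ω, P)`, has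
the property `Q`. -/
def InSquareMean (P : Measure Ω) (Q : (ℝ → Lp ℝ 2 P) → Prop) (X : ℝ → Ω → ℝ) : Prop :=
  ∃ hX : ∀ t, MemLp (X t) 2 P, Q (fun t => (hX t).toLp (X t))

/-- `L²`-bounded processes. -/
def IsL2Bounded (P : Measure Ω) (X : ℝ → Ω → ℝ) : Prop :=
  ∃ C : ℝ≥0, ∀ t, MemLp (X t) 2 P ∧ eLpNorm (X t) 2 P ≤ C

/-- Standard Brownian motion indexed by the real line. -/
structure IsTwoSidedBrownianMotion (P : Measure Ω) (W : ℝ → Ω → ℝ) : Prop where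
  zero : ∀ᵐ ω ∂P, W 0 ω = 0
  indep_increments : HasIndepIncrements W P
  increment_law : ∀ s t : ℝ, s ≤ t →
    HasLaw (fun ω => W t ω - W s ω) (gaussianReal 0 (t - s).toNNReal) P
  continuous_paths : ∀ᵐ ω ∂P, Continuous (fun t => W t ω)

/-- A step function on the line, `∑ cᵢ 1_{(aᵢ, bᵢ]}`. -/
structure StepData where
  n : ℕ
  a : Fin n → ℝ
  b : Fin n → ℝ
  c : Fin n → ℝ
  le : ∀ i, a i ≤ b i

/-- The function `∑ cᵢ 1_{(aᵢ, bᵢ]}`. -/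
def StepData.toFun (S : StepData) (s : ℝ) : ℝ :=
  ∑ i, (Ioc (S.a i) (S.b i)).indicator (fun _ => S.c i) s

/-- The elementary integral `∑ cᵢ (W(bᵢ) - W(aᵢ))`. -/
def StepData.integral (S : StepData) (W : ℝ → Ω → ℝ) (ω : Ω) : ℝ :=
  ∑ i, S.c i * (W (S.b i) ω - W (S.a i) ω)

/-- `I` is (a version of) the Wiener integral `∫ f dW` of the square-integrable function `f`:
the `L²(P)`-limit of the elementary integrals of step functions which converge to `f` in
`L²(ℝ)`. -/
def IsWienerIntegral (P : Measure Ω) (W : ℝ → Ω → ℝ) (f : ℝ → ℝ) (I : Ω → ℝ) : Prop :=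
  MemLp f 2 volume ∧ MemLp I 2 P ∧ ∃ S : ℕ → StepData,
    Tendsto (fun n => eLpNorm (fun s => (S n).toFun s - f s) 2 volume) atTop (𝓝 0) ∧
    Tendsto (fun n => eLpNorm (fun ω => (S n).integral W ω - I ω) 2 P) atTop (𝓝 0)

/-- `X` is a version with almost surely continuous paths of the process
`X(t) = √(2α) σ ∫_{-∞}^t e^{-α(t-s)} dW(s)`. -/
structure IsOrnsteinUhlenbeck (P : Measure Ω) (W : ℝ → Ω → ℝ) (α σ : ℝ) (X : ℝ → Ω → ℝ) :
    Prop where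
  integral : ∀ t : ℝ, ∃ I : Ω → ℝ,
    IsWienerIntegral P W ((Iic t).indicator fun s => Real.exp (-α * (t - s))) I ∧
    ∀ᵐ ω ∂P, X t ω = Real.sqrt (2 * α) * σ * I ω
  continuous_paths : ∀ᵐ ω ∂P, Continuous (fun t => X t ω)

/-- `X` solves `dX(t) = -α X(t) dt + √(2α) σ dW(t)` on the whole line. As the noise is additive, the
equation makes sense pathwise, and no adaptedness is demanded of a solution. -/
structure IsSolution (P : Measure Ω) (W : ℝ → Ω → ℝ) (α σ : ℝ) (X : ℝ → Ω → ℝ) : Prop where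
  aemeasurable : ∀ t, AEMeasurable (X t) P
  continuous_paths : ∀ᵐ ω ∂P, Continuous (fun t => X t ω)
  equation : ∀ᵐ ω ∂P, ∀ s t : ℝ, s ≤ t →
    X t ω - X s ω = (∫ u in s..t, -α * X u ω) + Real.sqrt (2 * α) * σ * (W t ω - W s ω)

/-- The `σ`-algebra generated by the increments of `W` up to time `t`. -/
abbrev pastIncrements (W : ℝ → Ω → ℝ) (t : ℝ) : MeasurableSpace Ω :=
  ⨆ (u : Iic t) (v : Iic t),
    MeasurableSpace.comap (fun ω => W (v : ℝ) ω - W (u : ℝ) ω) inferInstance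

/-- For every `t`, `X(t)` is almost surely equal to a random variable which is measurable with
respect to the increments of `W` up to time `t`. -/
def IsNonanticipating (P : Measure Ω) (W X : ℝ → Ω → ℝ) : Prop :=
  ∀ t : ℝ, AEStronglyMeasurable[pastIncrements W t] (X t) P

end AlmostAutomorphy

end

/-!
The space `L²(Ω, P)` sees the Ornstein-Uhlenbeck process as a curve whose values are far apart:
`E (X a - X b)² = 2σ² (1 - e^{-α|a-b|})`, which stays above a positive constant once `|a - b| ≥ 1`.
A pseudo almost automorphic `f = g + Φ` cannot have this property. The perturbation `Φ` is small on
average, and bounded intervals do not matter for this average, so `Φ` tends to zero along some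
sequence `tₙ` with `|tₙ| → ∞`; along a subsequence `g (tₙ)` converges as well, so that `f (tₙ)` is a
Cauchy sequence although its terms are far apart
(`not_isPseudoAlmostAutomorphic_of_separated`). The argument needs only a subadditive seminorm which
is compatible with translations (`not_isPseudoAlmostAutomorphicFor_of_separated`), so it covers the
Stepanov, Weyl and Besicovitch variants.

The rest is the theory of the process. The identity `E (W x - W y)² = |x - y|` is shared by Brownian
motion and by the functions `1_{(-∞, x]}` in `L²(ℝ)`, and it determines the second moments of all
linear combinations of increments (`HasBrownianVariogram.integral_sq`); this gives the Wiener
isometry. Wiener integrals are `L²`-limits of centred Gaussian variables, hence Gaussian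
(`hasLaw_gaussianReal_of_tendsto`).

For existence, the kernel is the mixture `1_{s ≤ t} e^{-α(t-s)} = E 1_{(t-U, t]}(s)`, where `U` has the
exponential law with parameter `α`. The same mixture of increments, `E_U (W t - W (t - U))`, is a
pathwise defined version of its Wiener integral: replacing `U` by a simple function of it gives
step functions, and by Jensen's inequality the error is controlled in both `L²` spaces at once by
the variogram (`HasBrownianVariogram.lintegral_mixture_sub_le`). Differentiating the mixture along a
path gives the equation (`pastDeviation_equation`).

Finally, two solutions differ by a path `e^{-αt} D(0)`, which is not bounded in `L²` as `t → -∞` unless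
it vanishes (`IsSolution.indistinguishable_of_isL2Bounded`). As pseudo almost automorphic functions
are bounded, a solution of this kind would be the Ornstein-Uhlenbeck process.
-/

namespace AlmostAutomorphy

/-! ### Ergodic perturbations are small along a sequence going to infinity -/

lemma IsAdmissibleWeight.tendsto_measure_Icc {μ : Measure ℝ} (hμ : IsAdmissibleWeight μ) :
    Tendsto (fun r : ℝ => μ (Icc (-r) r)) atTop (𝓝 ∞) := by
  have hmono : Monotone fun r : ℝ => Icc (-r) r := fun r s hrs =>
    Icc_subset_Icc (neg_le_neg hrs) hrs
  have hU : ⋃ r : ℝ, Icc (-r) r = univ :=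
    eq_univ_of_forall fun x => mem_iUnion.2 ⟨|x|, abs_le.1 le_rfl⟩
  rw [← hμ.1, ← hU]
  exact tendsto_measure_iUnion_atTop hmono

/-- A nonnegative function whose `μ`-mean tends to zero takes small values arbitrarily far from the
origin: a bounded interval has finite `μ`-measure, hence does not influence the mean. -/
lemma exists_lt_of_tendsto_mean_zero {μ : Measure ℝ} (hμ : IsAdmissibleWeight μ) {u : ℝ → ℝ≥0∞}
    (h : Tendsto (fun r : ℝ => (μ (Icc (-r) r))⁻¹ * ∫⁻ t in Icc (-r) r, u t ∂μ) atTop (𝓝 0))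
    (R : ℝ) {ε : ℝ≥0∞} (hε : ε ≠ 0) : ∃ t, R < |t| ∧ u t < ε := by
  by_contra! hcon
  set A := μ (Icc (-R) R)
  have hA : A ≠ ∞ := (hμ.2 _ _).ne
  have h1 : ∀ᶠ r : ℝ in atTop, 2 * A + 1 < μ (Icc (-r) r) :=
    hμ.tendsto_measure_Icc.eventually
      (lt_mem_nhds (ENNReal.add_lt_top.2 ⟨ENNReal.mul_lt_top (by simp) hA.lt_top, by simp⟩))
  have h2 := h.eventually (gt_mem_nhds (ENNReal.half_pos hε))
  obtain ⟨r, hr1, hr2⟩ := (h1.and h2).exists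
  set M := μ (Icc (-r) r)
  have hM : M ≠ ∞ := (hμ.2 _ _).ne
  have hM0 : M ≠ 0 := (bot_lt_of_lt hr1).ne'
  have h3 : M / 2 ≤ μ (Icc (-r) r \ Icc (-R) R) := by
    have : M / 2 + M / 2 ≤ μ (Icc (-r) r \ Icc (-R) R) + M / 2 := by
      rw [ENNReal.add_halves]
      calc M ≤ μ (Icc (-r) r \ Icc (-R) R) + A := by
            refine (measure_mono (t := (Icc (-r) r \ Icc (-R) R) ∪ Icc (-R) R) ?_).trans
              (measure_union_le _ _)
            intro x hx
            by_cases hx' : x ∈ Icc (-R) R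
            · exact Or.inr hx'
            · exact Or.inl ⟨hx, hx'⟩
        _ ≤ _ := by
            gcongr
            rw [ENNReal.le_div_iff_mul_le (by simp) (by simp), mul_comm]
            exact le_self_add.trans hr1.le
    exact (ENNReal.add_le_add_iff_right (ENNReal.div_ne_top hM (by simp))).1 this
  have h4 : ε * (M / 2) ≤ ∫⁻ t in Icc (-r) r, u t ∂μ := by
    calc ε * (M / 2) ≤ ε * μ (Icc (-r) r \ Icc (-R) R) := by gcongr
      _ = ∫⁻ t in Icc (-r) r \ Icc (-R) R, ε ∂μ := by rw [setLIntegral_const]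
      _ ≤ ∫⁻ t in Icc (-r) r \ Icc (-R) R, u t ∂μ := by
          refine setLIntegral_mono' (measurableSet_Icc.diff measurableSet_Icc) fun t ht => hcon t ?_
          by_contra! hle
          exact ht.2 (abs_le.1 hle)
      _ ≤ _ := lintegral_mono_set sdiff_subset
  refine absurd hr2 (not_lt.2 ?_)
  calc ε / 2 = M⁻¹ * (ε * (M / 2)) := by
        rw [div_eq_mul_inv, div_eq_mul_inv, mul_left_comm, ← mul_assoc M⁻¹,
          ENNReal.inv_mul_cancel hM0 hM, one_mul]
    _ ≤ _ := by gcongr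

/-- The sequence extracted from `exists_lt_of_tendsto_mean_zero`. -/
lemma exists_seq_of_tendsto_mean_zero {μ : Measure ℝ} (hμ : IsAdmissibleWeight μ) {u : ℝ → ℝ≥0∞}
    (h : Tendsto (fun r : ℝ => (μ (Icc (-r) r))⁻¹ * ∫⁻ t in Icc (-r) r, u t ∂μ) atTop (𝓝 0)) :
    ∃ t : ℕ → ℝ, Tendsto (fun n => |t n|) atTop atTop ∧ Tendsto (fun n => u (t n)) atTop (𝓝 0) := by
  choose t ht using fun n : ℕ =>
    exists_lt_of_tendsto_mean_zero hμ h n (ε := (n : ℝ≥0∞)⁻¹) (by simp)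
  exact ⟨t, tendsto_atTop_mono (fun n => (ht n).1.le) tendsto_natCast_atTop_atTop,
    tendsto_of_tendsto_of_tendsto_of_le_of_le tendsto_const_nhds
      ENNReal.tendsto_inv_nat_nhds_zero (fun _ => zero_le) fun n => (ht n).2.le⟩

lemma IsErgodic.tendsto_lintegral {E : Type*} [NormedAddCommGroup E] {μ : Measure ℝ}
    (hμ : IsAdmissibleWeight μ) {f : ℝ → E} (hf : IsErgodic μ f) :
    Tendsto (fun r : ℝ => (μ (Icc (-r) r))⁻¹ * ∫⁻ t in Icc (-r) r, ‖f t‖ₑ ∂μ) atTop (𝓝 0) := by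
  have h := ENNReal.tendsto_ofReal hf.2.2
  rw [ENNReal.ofReal_zero] at h
  refine h.congr' ?_
  filter_upwards [hμ.tendsto_measure_Icc.eventually (lt_mem_nhds ENNReal.zero_lt_top)] with r hr
  have hfin : μ (Icc (-r) r) ≠ ∞ := (hμ.2 _ _).ne
  have : IsFiniteMeasure (μ.restrict (Icc (-r) r)) := ⟨by simpa using hfin.lt_top⟩
  have hint : Integrable (fun t => ‖f t‖) (μ.restrict (Icc (-r) r)) := by
    obtain ⟨C, hC⟩ := hf.2.1
    exact Integrable.of_bound (hf.1.norm.aestronglyMeasurable) C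
      (ae_of_all _ fun t => by simpa using hC t)
  rw [ENNReal.ofReal_mul (by positivity), measureReal_def,
    ENNReal.ofReal_inv_of_pos (ENNReal.toReal_pos hr.ne' hfin), ENNReal.ofReal_toReal hfin,
    ofReal_integral_eq_lintegral_ofReal hint (ae_of_all _ fun t => norm_nonneg _)]
  simp_rw [ofReal_norm]

/-- Far apart times occur along any subsequence of a sequence which is unbounded. -/
lemma exists_far_of_tendsto_abs {t : ℕ → ℝ} (ht : Tendsto (fun n => |t n|) atTop atTop)
    {φ : ℕ → ℕ} (hφ : StrictMono φ) (N : ℕ) : ∃ n, N ≤ n ∧ 1 ≤ |t (φ N) - t (φ n)| := by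
  obtain ⟨n, hn, hn'⟩ := ((eventually_ge_atTop N).and ((ht.comp hφ.tendsto_atTop).eventually
    (eventually_ge_atTop (|t (φ N)| + 1)))).exists
  refine ⟨n, hn, ?_⟩
  have := abs_sub_abs_le_abs_sub (t (φ n)) (t (φ N))
  rw [abs_sub_comm]
  simp only [Function.comp_apply] at hn'
  linarith

/-! ### Uniformly separated functions are not pseudo almost automorphic -/

theorem not_isPseudoAlmostAutomorphic_of_separated {E : Type*} [NormedAddCommGroup E]
    {μ : Measure ℝ} (hμ : IsAdmissibleWeight μ) {f : ℝ → E} {δ : ℝ} (hδ : 0 < δ)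
    (hf : ∀ a b, 1 ≤ |a - b| → δ ≤ ‖f a - f b‖) : ¬ IsPseudoAlmostAutomorphic μ f := by
  rintro ⟨g, Φ, hg, hΦ, hfg⟩
  obtain ⟨t, ht, hΦt⟩ := exists_seq_of_tendsto_mean_zero hμ (hΦ.tendsto_lintegral hμ)
  obtain ⟨φ, hφ, k, hk⟩ := hg.2 t
  have h1 : Tendsto (fun n => f (t (φ n))) atTop (𝓝 (k 0)) := by
    have hk0 := (hk 0).1
    have h2 : Tendsto (fun n => Φ (t (φ n))) atTop (𝓝 0) := by
      rw [tendsto_zero_iff_enorm_tendsto_zero]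
      exact hΦt.comp hφ.tendsto_atTop
    simpa [hfg] using hk0.add h2
  obtain ⟨N, hN⟩ := Metric.cauchySeq_iff'.1 h1.cauchySeq δ hδ
  obtain ⟨n, hn, hfar⟩ := exists_far_of_tendsto_abs ht hφ N
  have := hN n hn
  rw [dist_comm, dist_eq_norm] at this
  exact absurd (hf _ _ hfar) (not_le.2 this)

/-- The seminorm version of `not_isPseudoAlmostAutomorphic_of_separated`. Only the local seminorm
at the origin has to be subadditive and, up to a constant, compatible with translations. -/
theorem not_isPseudoAlmostAutomorphicFor_of_separated {E : Type*} [NormedAddCommGroup E]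
    {L : (ℝ → E) → Prop} {N : (ℝ → E) → ℝ → ℝ≥0∞} {B : (ℝ → E) → ℝ≥0∞}
    {μ : Measure ℝ} (hμ : IsAdmissibleWeight μ) {C : ℝ≥0∞} (hC : C ≠ ∞)
    (hadd : ∀ h₁ h₂, L h₁ → L h₂ →
      L (fun s => h₁ s + h₂ s) ∧ N (fun s => h₁ s + h₂ s) 0 ≤ N h₁ 0 + N h₂ 0)
    (hsub : ∀ h₁ h₂, L h₁ → L h₂ →
      L (fun s => h₁ s - h₂ s) ∧ N (fun s => h₁ s - h₂ s) 0 ≤ N h₁ 0 + N h₂ 0)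
    (htrans : ∀ h a, L h →
      L (fun s => h (s + a)) ∧ N (fun s => h (s + a)) 0 ≤ C * N h a)
    {f : ℝ → E} {δ : ℝ≥0∞} (hδ : δ ≠ 0)
    (hf : ∀ a b, 1 ≤ |a - b| → δ ≤ N (fun s => f (s + a) - f (s + b)) 0) :
    ¬ IsPseudoAlmostAutomorphicFor L N B μ f := by
  rintro ⟨g, Φ, ⟨hgL, -, hg⟩, ⟨hΦL, -, -, hΦ⟩, hfg⟩
  obtain ⟨t, ht, hΦt⟩ := exists_seq_of_tendsto_mean_zero hμ hΦ
  obtain ⟨φ, hφ, k, hkL, hk⟩ := hg t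
  set e : ℕ → ℝ → E := fun n s => f (s + t (φ n)) - k s with he
  have he' : ∀ n, e n = fun s => (g (s + t (φ n)) - k s) + Φ (s + t (φ n)) := fun n => by
    funext s; simp only [he, hfg]; abel
  have heL : ∀ n, L (e n) ∧
      N (e n) 0 ≤ N (fun s => g (s + t (φ n)) - k s) 0 + C * N Φ (t (φ n)) := fun n => by
    have h1 := hadd _ _ (hsub _ _ (htrans g (t (φ n)) hgL).1 hkL).1 (htrans Φ (t (φ n)) hΦL).1
    rw [he']
    exact ⟨h1.1, h1.2.trans (add_le_add le_rfl (htrans Φ (t (φ n)) hΦL).2)⟩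
  have he0 : Tendsto (fun n => N (e n) 0) atTop (𝓝 0) := by
    have h2 := (hk 0).1.add
      (ENNReal.Tendsto.const_mul (a := C) (hΦt.comp hφ.tendsto_atTop) (Or.inr hC))
    rw [mul_zero, add_zero] at h2
    exact tendsto_of_tendsto_of_tendsto_of_le_of_le tendsto_const_nhds h2 (fun _ => zero_le)
      fun n => (heL n).2
  obtain ⟨M, hM⟩ := eventually_atTop.1 (he0.eventually (gt_mem_nhds (ENNReal.half_pos hδ)))
  obtain ⟨n, hn, hfar⟩ := exists_far_of_tendsto_abs ht hφ M
  have h3 := hf _ _ hfar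
  have h4 : (fun s => f (s + t (φ M)) - f (s + t (φ n))) = fun s => e M s - e n s := by
    funext s; simp [he]
  rw [h4] at h3
  have h5 := h3.trans (hsub _ _ (heL M).1 (heL n).1).2
  have h6 := ENNReal.add_lt_add (hM M le_rfl) (hM n hn)
  rw [ENNReal.add_halves] at h6
  exact absurd h5 (not_le.2 h6)

lemma IsAlmostAutomorphic.exists_norm_le {E : Type*} [NormedAddCommGroup E] {g : ℝ → E}
    (hg : IsAlmostAutomorphic g) : ∃ C : ℝ, ∀ t, ‖g t‖ ≤ C := by
  by_contra! hcon
  choose t ht using fun n : ℕ => hcon n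
  obtain ⟨φ, hφ, k, hk⟩ := hg.2 t
  have h1 := (hk 0).1.norm
  simp only [zero_add] at h1
  refine not_tendsto_nhds_of_tendsto_atTop ?_ _ h1
  exact tendsto_atTop_mono (fun n => (ht (φ n)).le)
    (tendsto_natCast_atTop_atTop.comp hφ.tendsto_atTop)

lemma IsPseudoAlmostAutomorphic.exists_norm_le {E : Type*} [NormedAddCommGroup E] {μ : Measure ℝ}
    {f : ℝ → E} (hf : IsPseudoAlmostAutomorphic μ f) : ∃ C : ℝ, ∀ t, ‖f t‖ ≤ C := by
  obtain ⟨g, Φ, hg, ⟨-, ⟨C', hΦ⟩, -⟩, hfg⟩ := hf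
  obtain ⟨C, hC⟩ := hg.exists_norm_le
  exact ⟨C + C', fun t => by rw [hfg]; exact (norm_add_le _ _).trans (add_le_add (hC t) (hΦ t))⟩

lemma IsAlmostAutomorphic.isPseudoAlmostAutomorphic {E : Type*} [NormedAddCommGroup E] {g : ℝ → E}
    (hg : IsAlmostAutomorphic g) (μ : Measure ℝ) : IsPseudoAlmostAutomorphic μ g :=
  ⟨g, 0, hg, ⟨continuous_const, ⟨0, by simp⟩, by simp⟩, by simp⟩

lemma isAdmissibleWeight_volume : IsAdmissibleWeight volume :=
  ⟨Real.volume_univ, fun _ _ => measure_Icc_lt_top⟩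

/-! ### The Stepanov, Weyl and Besicovitch seminorms -/

variable {E : Type*} [NormedAddCommGroup E]

lemma stepanovAt_two_eq_eLpNorm (ν : Measure (Icc (0 : ℝ) 1)) (h : ℝ → E) (t : ℝ) :
    stepanovAt 2 ν h t = eLpNorm (fun s : Icc (0 : ℝ) 1 => h (t + (s : ℝ))) 2 ν := by
  rw [stepanovAt, eLpNorm_eq_lintegral_rpow_enorm_toReal (by simp) (by simp)]
  simp

theorem not_isStepanovPAA_of_separated {μ : Measure ℝ} (hμ : IsAdmissibleWeight μ)
    {ν : Measure (Icc (0 : ℝ) 1)} (hν : 0 < ν univ) {f : ℝ → E} {δ : ℝ}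
    (hδ : 0 < δ) (hf : ∀ a b, 1 ≤ |a - b| → δ ≤ ‖f a - f b‖) : ¬ IsStepanovPAA 2 ν μ f := by
  refine not_isPseudoAlmostAutomorphicFor_of_separated (C := 1) hμ (by simp) ?_ ?_ ?_
    (f := f) (δ := (ENNReal.ofReal δ ^ (2 : ℝ) * ν univ) ^ (1 / 2 : ℝ)) ?_ ?_
  · intro h₁ h₂ H₁ H₂
    refine ⟨fun t => (H₁ t).add (H₂ t), ?_⟩
    simp only [stepanovAt_two_eq_eLpNorm]
    exact eLpNorm_add_le (H₁ 0).1 (H₂ 0).1 (by simp)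
  · intro h₁ h₂ H₁ H₂
    refine ⟨fun t => (H₁ t).sub (H₂ t), ?_⟩
    simp only [stepanovAt_two_eq_eLpNorm]
    exact eLpNorm_sub_le (H₁ 0).1 (H₂ 0).1 (by simp)
  · intro h a H
    refine ⟨fun t => ?_, ?_⟩
    · simpa [add_right_comm] using H (t + a)
    · simp [stepanovAt, add_comm]
  · have := ENNReal.ofReal_pos.2 hδ
    simp [hν.ne', hδ]
  · intro a b hab
    rw [stepanovAt]
    gcongr
    rw [← lintegral_const]
    refine lintegral_mono fun s => ?_
    have := hf (0 + s + a) (0 + s + b) (by simpa using hab)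
    gcongr
    rw [← ofReal_norm]
    exact ENNReal.ofReal_le_ofReal this

lemma windowMean_two_eq_eLpNorm (h : ℝ → E) (x r : ℝ) :
    windowMean 2 h x r = eLpNorm h 2
      ((ENNReal.ofReal (2 * r))⁻¹ • volume.restrict (Icc (x - r) (x + r))) := by
  rw [windowMean, eLpNorm_eq_lintegral_rpow_enorm_toReal (by simp) (by simp), lintegral_smul_measure]
  simp

lemma windowMean_comp_add (p : ℝ) (h : ℝ → E) (a x r : ℝ) :
    windowMean p (fun s => h (s + a)) x r = windowMean p h (x + a) r := by
  rw [windowMean, windowMean]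
  congr 2
  have := (measurePreserving_add_right (volume : Measure ℝ) a).setLIntegral_comp_preimage_emb
    (measurableEmbedding_addRight a) (fun t => ‖h t‖ₑ ^ p) (Icc (x + a - r) (x + a + r))
  rw [← this]
  congr 2
  ext s
  simp only [mem_Icc, mem_preimage]
  constructor <;> rintro ⟨h1, h2⟩ <;> constructor <;> linarith

lemma LocallyPIntegrable.comp_add {p : ℝ} {h : ℝ → E} (H : LocallyPIntegrable p h) (a : ℝ) :
    LocallyPIntegrable p fun s => h (s + a) := by
  intro c d
  have hmp := (measurePreserving_add_right (volume : Measure ℝ) a).restrict_preimage_emb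
    (measurableEmbedding_addRight a) (Icc (c + a) (d + a))
  have := (H (c + a) (d + a)).comp_measurePreserving hmp
  simpa [Function.comp_def] using this

lemma LocallyPIntegrable.aestronglyMeasurable_window {p : ℝ} {h : ℝ → E}
    (H : LocallyPIntegrable p h) (c : ℝ≥0∞) (a b : ℝ) :
    AEStronglyMeasurable h (c • volume.restrict (Icc a b)) :=
  (H a b).1.smul_measure c

lemma limsup_add_le_of_ennreal {α : Type*} {F : Filter α} (u v : α → ℝ≥0∞) :
    limsup (fun x => u x + v x) F ≤ limsup u F + limsup v F := by
  refine ENNReal.le_of_forall_pos_le_add fun ε hε hfin => ?_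
  have hε' : (ε / 2 : ℝ≥0∞) ≠ 0 := by simpa using hε.ne'
  rw [ENNReal.add_lt_top] at hfin
  have hu := eventually_lt_of_limsup_lt (ENNReal.lt_add_right hfin.1.ne hε')
  have hv := eventually_lt_of_limsup_lt (ENNReal.lt_add_right hfin.2.ne hε')
  refine limsup_le_of_le (by isBoundedDefault) ?_
  filter_upwards [hu, hv] with x h1 h2
  calc u x + v x ≤ (limsup u F + ε / 2) + (limsup v F + ε / 2) := add_le_add h1.le h2.le
    _ = limsup u F + limsup v F + (ε / 2 + ε / 2) := by ring
    _ = _ := by rw [ENNReal.add_halves]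

lemma weylAt_add_le {h₁ h₂ : ℝ → E} (H₁ : LocallyPIntegrable 2 h₁) (H₂ : LocallyPIntegrable 2 h₂)
    (x : ℝ) : weylAt 2 (fun s => h₁ s + h₂ s) x ≤ weylAt 2 h₁ x + weylAt 2 h₂ x := by
  refine le_trans (limsup_le_limsup (Eventually.of_forall fun r => ?_)
    (by isBoundedDefault) (by isBoundedDefault)) (limsup_add_le_of_ennreal _ _)
  simp only [windowMean_two_eq_eLpNorm]
  exact eLpNorm_add_le (H₁.aestronglyMeasurable_window _ _ _)
    (H₂.aestronglyMeasurable_window _ _ _) (by simp)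

lemma weylAt_sub_le {h₁ h₂ : ℝ → E} (H₁ : LocallyPIntegrable 2 h₁) (H₂ : LocallyPIntegrable 2 h₂)
    (x : ℝ) : weylAt 2 (fun s => h₁ s - h₂ s) x ≤ weylAt 2 h₁ x + weylAt 2 h₂ x := by
  refine le_trans (limsup_le_limsup (Eventually.of_forall fun r => ?_)
    (by isBoundedDefault) (by isBoundedDefault)) (limsup_add_le_of_ennreal _ _)
  simp only [windowMean_two_eq_eLpNorm]
  exact eLpNorm_sub_le (H₁.aestronglyMeasurable_window _ _ _)
    (H₂.aestronglyMeasurable_window _ _ _) (by simp)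

/-- Up to a constant, the local Weyl seminorms do not depend on the point: for `|x| ≤ r` the window
of radius `r` about `x` lies in the window of radius `2r` about the origin. -/
lemma weylAt_two_le_besicovitchNorm (h : ℝ → E) (x : ℝ) :
    weylAt 2 h x ≤ 2 ^ (1 / 2 : ℝ) * besicovitchNorm 2 h := by
  have h1 : ∀ᶠ r : ℝ in atTop, windowMean 2 h x r ≤ 2 ^ (1 / 2 : ℝ) * windowMean 2 h 0 (2 * r) := by
    filter_upwards [eventually_ge_atTop |x|, eventually_gt_atTop 0] with r hr hr0
    rw [windowMean, windowMean, ← ENNReal.mul_rpow_of_nonneg _ _ (by norm_num), ← mul_assoc]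
    have h2 : (2 : ℝ≥0∞) * (ENNReal.ofReal (2 * (2 * r)))⁻¹ = (ENNReal.ofReal (2 * r))⁻¹ := by
      rw [ENNReal.ofReal_mul (p := 2) zero_le_two, ENNReal.ofReal_ofNat,
        ENNReal.mul_inv (Or.inl two_ne_zero) (Or.inl ENNReal.ofNat_ne_top), ← mul_assoc,
        ENNReal.mul_inv_cancel two_ne_zero ENNReal.ofNat_ne_top, one_mul]
    rw [h2]
    have h3 : Icc (x - r) (x + r) ⊆ Icc (0 - 2 * r) (0 + 2 * r) := by
      have := abs_le.1 hr
      exact Icc_subset_Icc (by linarith) (by linarith)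
    exact ENNReal.rpow_le_rpow (mul_le_mul_right (lintegral_mono_set h3) _) (by norm_num)
  calc weylAt 2 h x ≤ limsup (fun r => 2 ^ (1 / 2 : ℝ) * windowMean 2 h 0 (2 * r)) atTop :=
        limsup_le_limsup h1 (by isBoundedDefault) (by isBoundedDefault)
    _ = 2 ^ (1 / 2 : ℝ) * limsup (fun r => windowMean 2 h 0 (2 * r)) atTop :=
        ENNReal.limsup_const_mul_of_ne_top (by simp)
    _ ≤ _ := by
        gcongr
        have htend : Tendsto (fun r : ℝ => 2 * r) atTop atTop :=
          tendsto_id.const_mul_atTop (by norm_num)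
        calc limsup (fun r => windowMean 2 h 0 (2 * r)) atTop
            = limsup (windowMean 2 h 0) (map (fun r : ℝ => 2 * r) atTop) :=
              limsup_comp (windowMean 2 h 0) (fun r : ℝ => 2 * r) atTop
          _ ≤ limsup (windowMean 2 h 0) atTop :=
              limsup_le_limsup_of_le htend (by isBoundedDefault) (by isBoundedDefault)

lemma le_weylAt_of_separated {f : ℝ → E} {δ : ℝ}
    (hf : ∀ a b, 1 ≤ |a - b| → δ ≤ ‖f a - f b‖) {a b : ℝ} (hab : 1 ≤ |a - b|) (x : ℝ) :
    ENNReal.ofReal δ ≤ weylAt 2 (fun s => f (s + a) - f (s + b)) x := by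
  refine le_limsup_of_frequently_le (Eventually.frequently ?_) (by isBoundedDefault)
  filter_upwards [eventually_gt_atTop 0] with r hr
  rw [windowMean]
  have h1 : (ENNReal.ofReal δ ^ (2 : ℝ)) ^ (1 / 2 : ℝ) = ENNReal.ofReal δ := by
    rw [← ENNReal.rpow_mul]; norm_num
  rw [← h1]
  gcongr
  have hvol : volume (Icc (x - r) (x + r)) = ENNReal.ofReal (2 * r) := by
    rw [Real.volume_Icc]; congr 1; ring
  calc ENNReal.ofReal δ ^ (2 : ℝ)
      = (ENNReal.ofReal (2 * r))⁻¹ * ∫⁻ t in Icc (x - r) (x + r), ENNReal.ofReal δ ^ (2 : ℝ) := by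
        rw [setLIntegral_const, hvol, mul_left_comm, ENNReal.inv_mul_cancel, mul_one]
        · simpa using hr
        · exact ENNReal.ofReal_ne_top
    _ ≤ _ := by
        gcongr with s
        rw [← ofReal_norm]
        exact ENNReal.ofReal_le_ofReal (hf _ _ (by simpa using hab))

theorem not_isWeylPAA_of_separated {μ : Measure ℝ} (hμ : IsAdmissibleWeight μ) {f : ℝ → E} {δ : ℝ}
    (hδ : 0 < δ) (hf : ∀ a b, 1 ≤ |a - b| → δ ≤ ‖f a - f b‖) : ¬ IsWeylPAA 2 μ f := by
  refine not_isPseudoAlmostAutomorphicFor_of_separated (C := 1) hμ (by simp)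
    (fun h₁ h₂ H₁ H₂ => ⟨fun a b => (H₁ a b).add (H₂ a b), weylAt_add_le H₁ H₂ 0⟩)
    (fun h₁ h₂ H₁ H₂ => ⟨fun a b => (H₁ a b).sub (H₂ a b), weylAt_sub_le H₁ H₂ 0⟩)
    (fun h a H => ⟨H.comp_add a, ?_⟩) (ENNReal.ofReal_pos.2 hδ).ne'
    (fun a b hab => le_weylAt_of_separated hf hab 0)
  simp [weylAt, windowMean_comp_add]

theorem not_isBesicovitchPAA_of_separated {μ : Measure ℝ} (hμ : IsAdmissibleWeight μ) {f : ℝ → E}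
    {δ : ℝ} (hδ : 0 < δ) (hf : ∀ a b, 1 ≤ |a - b| → δ ≤ ‖f a - f b‖) :
    ¬ IsBesicovitchPAA 2 μ f := by
  refine not_isPseudoAlmostAutomorphicFor_of_separated (C := 2 ^ (1 / 2 : ℝ))
    (N := fun h _ => besicovitchNorm 2 h) hμ (by simp)
    (fun h₁ h₂ H₁ H₂ => ⟨fun a b => (H₁ a b).add (H₂ a b), weylAt_add_le H₁ H₂ 0⟩)
    (fun h₁ h₂ H₁ H₂ => ⟨fun a b => (H₁ a b).sub (H₂ a b), weylAt_sub_le H₁ H₂ 0⟩)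
    (fun h a H => ⟨H.comp_add a, ?_⟩) (ENNReal.ofReal_pos.2 hδ).ne'
    (fun a b hab => le_weylAt_of_separated hf hab 0)
  refine le_trans (le_of_eq ?_) (weylAt_two_le_besicovitchNorm h a)
  simp [weylAt, besicovitchNorm, windowMean_comp_add]

end AlmostAutomorphy

namespace AlmostAutomorphy

/-! ### Processes whose increments have variance `|x - y|` -/

/-- The increments of `Z` are square-integrable and `∫ (Z x - Z y)² dQ = |x - y|`. This is the only
feature of Brownian motion which enters the Wiener isometry. The indicator functions
`x ↦ 1_{(-∞, x]}` on the real line with Lebesgue measure have it as well, and the isometry amounts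
to comparing these two examples. -/
def HasBrownianVariogram {S : Type*} [MeasurableSpace S] (Q : Measure S) (Z : ℝ → S → ℝ) : Prop :=
  ∀ x y : ℝ, MemLp (fun s => Z x s - Z y s) 2 Q ∧ ∫ s, (Z x s - Z y s) ^ 2 ∂Q = |x - y|

/-- The functions `1_{(-∞, x]}`, regarded as a process indexed by `x`. -/
noncomputable def heaviside (x s : ℝ) : ℝ := (Iic x).indicator (fun _ => 1) s

lemma heaviside_sub_heaviside {a b : ℝ} (hab : a ≤ b) (s : ℝ) :
    heaviside b s - heaviside a s = (Ioc a b).indicator (fun _ => 1) s := by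
  simp only [heaviside, indicator, mem_Iic, mem_Ioc]
  grind

lemma hasBrownianVariogram_heaviside : HasBrownianVariogram volume heaviside := by
  have key : ∀ x y : ℝ, x ≤ y → MemLp (fun s => heaviside y s - heaviside x s) 2 volume ∧
      ∫ s, (heaviside y s - heaviside x s) ^ 2 = y - x := by
    intro x y hxy
    simp only [heaviside_sub_heaviside hxy]
    refine ⟨memLp_indicator_const 2 measurableSet_Ioc 1 (Or.inr (by simp)), ?_⟩
    have : ∀ s, ((Ioc x y).indicator (fun _ => (1 : ℝ)) s) ^ 2 = (Ioc x y).indicator 1 s := by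
      intro s
      simp only [indicator, Pi.one_apply]
      split_ifs <;> simp
    simp only [this]
    rw [integral_indicator_one measurableSet_Ioc]
    simp [hxy]
  intro x y
  rcases le_total x y with h | h
  · have h1 := key x y h
    refine ⟨by simpa [Pi.neg_def] using h1.1.neg, ?_⟩
    rw [abs_sub_comm, abs_of_nonneg (sub_nonneg.2 h), ← h1.2]
    exact integral_congr_ae (ae_of_all _ fun s => by ring)
  · rw [abs_of_nonneg (sub_nonneg.2 h)]
    exact key y x h

lemma StepData.toFun_eq_integral_heaviside (S : StepData) : S.toFun = S.integral heaviside := by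
  funext s
  refine Finset.sum_congr rfl fun i _ => ?_
  rw [heaviside_sub_heaviside (S.le i)]
  simp [indicator]

variable {Ω : Type*} [MeasurableSpace Ω]

lemma hasBrownianVariogram_of_isTwoSidedBrownianMotion {P : Measure Ω} {W : ℝ → Ω → ℝ}
    (hW : IsTwoSidedBrownianMotion P W) : HasBrownianVariogram P W := by
  have key : ∀ x y : ℝ, x ≤ y → MemLp (fun s => W y s - W x s) 2 P ∧
      ∫ s, (W y s - W x s) ^ 2 ∂P = y - x := by
    intro x y hxy
    have h1 := hW.increment_law x y hxy
    have h2 : MemLp (fun s => W y s - W x s) 2 P := by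
      have := h1.hasGaussianLaw.memLp_two
      exact this
    refine ⟨h2, ?_⟩
    have h3 : ∫ s, (fun z : ℝ => z ^ 2) (W y s - W x s) ∂P
        = ∫ z, z ^ 2 ∂(gaussianReal 0 (y - x).toNNReal) := by
      rw [← h1.map_eq, integral_map h1.aemeasurable (by fun_prop)]
    have h4 : Var[fun z => z; gaussianReal 0 (y - x).toNNReal] = y - x := by
      rw [variance_fun_id_gaussianReal, Real.coe_toNNReal _ (sub_nonneg.2 hxy)]
    rw [variance_of_integral_eq_zero (by fun_prop) (by simp)] at h4
    exact h3.trans h4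
  intro x y
  rcases le_total x y with h | h
  · have h1 := key x y h
    refine ⟨by simpa [Pi.neg_def] using h1.1.neg, ?_⟩
    rw [abs_sub_comm, abs_of_nonneg (sub_nonneg.2 h), ← h1.2]
    exact integral_congr_ae (ae_of_all _ fun s => by ring)
  · rw [abs_of_nonneg (sub_nonneg.2 h)]
    exact key y x h

variable {S : Type*} [MeasurableSpace S] {Q : Measure S} {Z : ℝ → S → ℝ}

lemma HasBrownianVariogram.integral_mul (hZ : HasBrownianVariogram Q Z) (a b c d : ℝ) :
    ∫ s, (Z b s - Z a s) * (Z d s - Z c s) ∂Q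
      = (|b - c| + |a - d| - |b - d| - |a - c|) / 2 := by
  have h1 : ∀ s, (Z b s - Z a s) * (Z d s - Z c s) = ((Z b s - Z c s) ^ 2 + (Z a s - Z d s) ^ 2
      - (Z b s - Z d s) ^ 2 - (Z a s - Z c s) ^ 2) / 2 := fun s => by ring
  simp only [h1]
  have hbc := (hZ b c).1.integrable_sq
  have had := (hZ a d).1.integrable_sq
  have hbd := (hZ b d).1.integrable_sq
  have hs : Integrable (fun s => (Z b s - Z c s) ^ 2 + (Z a s - Z d s) ^ 2) Q := hbc.add had
  have hs' : Integrable (fun s => (Z b s - Z c s) ^ 2 + (Z a s - Z d s) ^ 2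
      - (Z b s - Z d s) ^ 2) Q := hs.sub hbd
  rw [integral_div, integral_sub hs' (hZ a c).1.integrable_sq, integral_sub hs hbd, integral_add hbc had,
    (hZ b c).2, (hZ a d).2, (hZ b d).2, (hZ a c).2]

lemma HasBrownianVariogram.memLp_integral (hZ : HasBrownianVariogram Q Z) (D : StepData) :
    MemLp (D.integral Z) 2 Q :=
  memLp_finsetSum _ fun i _ => (hZ (D.b i) (D.a i)).1.const_mul (D.c i)

lemma HasBrownianVariogram.integral_sq (hZ : HasBrownianVariogram Q Z) (D : StepData) :
    ∫ s, (D.integral Z s) ^ 2 ∂Q = ∑ i, ∑ j, D.c i * D.c j *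
      ((|D.b i - D.a j| + |D.a i - D.b j| - |D.b i - D.b j| - |D.a i - D.a j|) / 2) := by
  have h1 : ∀ s, (D.integral Z s) ^ 2 = ∑ i, ∑ j, D.c i * D.c j *
      ((Z (D.b i) s - Z (D.a i) s) * (Z (D.b j) s - Z (D.a j) s)) := fun s => by
    rw [StepData.integral, sq, Finset.sum_mul_sum]
    exact Finset.sum_congr rfl fun i _ => Finset.sum_congr rfl fun j _ => by ring
  have h2 : ∀ i j, Integrable (fun s => D.c i * D.c j *
      ((Z (D.b i) s - Z (D.a i) s) * (Z (D.b j) s - Z (D.a j) s))) Q := fun i j =>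
    ((hZ _ _).1.integrable_mul (hZ _ _).1).const_mul _
  simp only [h1]
  rw [integral_finsetSum _ fun i _ => integrable_finsetSum _ fun j _ => h2 i j]
  refine Finset.sum_congr rfl fun i _ => ?_
  rw [integral_finsetSum _ fun j _ => h2 i j]
  refine Finset.sum_congr rfl fun j _ => ?_
  rw [integral_const_mul, hZ.integral_mul]

lemma eLpNorm_two_eq_ofReal {f : S → ℝ} (hf : MemLp f 2 Q) :
    eLpNorm f 2 Q = ENNReal.ofReal (√(∫ s, f s ^ 2 ∂Q)) := by
  rw [hf.eLpNorm_eq_integral_rpow_norm (by simp) (by simp), Real.sqrt_eq_rpow]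
  simp

/-- The Wiener isometry for step functions, in the form of a comparison of any two processes with
the same variogram. -/
lemma HasBrownianVariogram.eLpNorm_integral_eq {S' : Type*} [MeasurableSpace S'] {Q' : Measure S'}
    {Z' : ℝ → S' → ℝ} (hZ : HasBrownianVariogram Q Z) (hZ' : HasBrownianVariogram Q' Z')
    (D : StepData) : eLpNorm (D.integral Z) 2 Q = eLpNorm (D.integral Z') 2 Q' := by
  rw [eLpNorm_two_eq_ofReal (hZ.memLp_integral D), eLpNorm_two_eq_ofReal (hZ'.memLp_integral D),
    hZ.integral_sq, hZ'.integral_sq]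

lemma HasBrownianVariogram.eLpNorm_integral (hZ : HasBrownianVariogram Q Z) (D : StepData) :
    eLpNorm (D.integral Z) 2 Q = eLpNorm D.toFun 2 volume := by
  rw [D.toFun_eq_integral_heaviside]
  exact hZ.eLpNorm_integral_eq hasBrownianVariogram_heaviside D

/-! ### Linear combinations of step functions -/

/-- The step function `c • D`. -/
def StepData.smul (c : ℝ) (D : StepData) : StepData where
  n := D.n
  a := D.a
  b := D.b
  c := fun i => c * D.c i
  le := D.le

/-- The sum of two step functions, obtained by joining the lists of their intervals. -/
def StepData.add (D D' : StepData) : StepData where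
  n := D.n + D'.n
  a := Fin.append D.a D'.a
  b := Fin.append D.b D'.b
  c := Fin.append D.c D'.c
  le := fun i => by
    refine Fin.addCases (fun j => ?_) (fun j => ?_) i
    · simpa using D.le j
    · simpa using D'.le j

lemma StepData.integral_smul {T : Type*} (c : ℝ) (D : StepData) (Z : ℝ → T → ℝ) (s : T) :
    (D.smul c).integral Z s = c * D.integral Z s := by
  simp only [StepData.integral, StepData.smul, Finset.mul_sum, mul_assoc]
  rfl

lemma StepData.integral_add {T : Type*} (D D' : StepData) (Z : ℝ → T → ℝ) (s : T) :
    (D.add D').integral Z s = D.integral Z s + D'.integral Z s := by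
  refine (Fin.sum_univ_add (fun i : Fin (D.n + D'.n) => Fin.append D.c D'.c i *
    (Z (Fin.append D.b D'.b i) s - Z (Fin.append D.a D'.a i) s))).trans ?_
  simp only [Fin.append_left, Fin.append_right]
  rfl

lemma StepData.toFun_smul (c : ℝ) (D : StepData) (s : ℝ) :
    (D.smul c).toFun s = c * D.toFun s := by
  simp only [StepData.toFun_eq_integral_heaviside, StepData.integral_smul]

lemma StepData.toFun_add (D D' : StepData) (s : ℝ) :
    (D.add D').toFun s = D.toFun s + D'.toFun s := by
  simp only [StepData.toFun_eq_integral_heaviside, StepData.integral_add]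

/-! ### The Wiener integral is linear and isometric -/

lemma tendsto_eLpNorm_of_tendsto_eLpNorm_sub {F : ℕ → S → ℝ} {f : S → ℝ}
    (hF : ∀ n, MemLp (F n) 2 Q) (hf : MemLp f 2 Q)
    (h : Tendsto (fun n => eLpNorm (fun s => F n s - f s) 2 Q) atTop (𝓝 0)) :
    Tendsto (fun n => eLpNorm (F n) 2 Q) atTop (𝓝 (eLpNorm f 2 Q)) := by
  have h1 := ((Lp.tendsto_Lp_iff_tendsto_eLpNorm'' F hF f hf).2 h).enorm
  simpa [Lp.enorm_toLp] using h1

lemma integral_add_sq {u v : S → ℝ} (hu : MemLp u 2 Q) (hv : MemLp v 2 Q) :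
    ∫ x, (u x + v x) ^ 2 ∂Q = (∫ x, u x ^ 2 ∂Q) + 2 * (∫ x, u x * v x ∂Q) + ∫ x, v x ^ 2 ∂Q := by
  have huv : Integrable (fun x => u x * v x) Q := hu.integrable_mul hv
  simp only [add_sq, mul_assoc]
  have hs : Integrable (fun x => u x ^ 2 + 2 * (u x * v x)) Q :=
    hu.integrable_sq.add (huv.const_mul 2)
  rw [integral_add hs hv.integrable_sq,
    integral_add hu.integrable_sq (huv.const_mul 2), integral_const_mul]

section WienerIntegral

variable {P : Measure Ω} {W : ℝ → Ω → ℝ} {f g : ℝ → ℝ} {I J : Ω → ℝ}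

lemma IsWienerIntegral.congr (h : IsWienerIntegral P W f I) (hIJ : I =ᵐ[P] J) :
    IsWienerIntegral P W f J := by
  obtain ⟨hf, hI, D, hDf, hDI⟩ := h
  refine ⟨hf, (memLp_congr_ae hIJ).1 hI, D, hDf, hDI.congr fun n => eLpNorm_congr_ae ?_⟩
  filter_upwards [hIJ] with ω hω
  rw [hω]

lemma IsWienerIntegral.const_mul (h : IsWienerIntegral P W f I) (c : ℝ) :
    IsWienerIntegral P W (fun s => c * f s) (fun ω => c * I ω) := by
  obtain ⟨hf, hI, D, hDf, hDI⟩ := h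
  refine ⟨hf.const_mul c, hI.const_mul c, fun n => (D n).smul c, ?_, ?_⟩
  · have := ENNReal.Tendsto.const_mul (a := ‖c‖ₑ) hDf (Or.inr (by simp))
    rw [mul_zero] at this
    refine this.congr fun n => ?_
    rw [← eLpNorm_const_smul]
    congr 1; funext s
    simp only [StepData.toFun_smul, Pi.smul_apply, smul_eq_mul]; ring
  · have := ENNReal.Tendsto.const_mul (a := ‖c‖ₑ) hDI (Or.inr (by simp))
    rw [mul_zero] at this
    refine this.congr fun n => ?_
    rw [← eLpNorm_const_smul]
    congr 1; funext s
    simp only [StepData.integral_smul, Pi.smul_apply, smul_eq_mul]; ring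

lemma tendsto_eLpNorm_add_zero {F G : ℕ → S → ℝ}
    (hF : ∀ n, AEStronglyMeasurable (F n) Q) (hG : ∀ n, AEStronglyMeasurable (G n) Q)
    (hF0 : Tendsto (fun n => eLpNorm (F n) 2 Q) atTop (𝓝 0))
    (hG0 : Tendsto (fun n => eLpNorm (G n) 2 Q) atTop (𝓝 0)) :
    Tendsto (fun n => eLpNorm (F n + G n) 2 Q) atTop (𝓝 0) := by
  have := hF0.add hG0
  rw [add_zero] at this
  exact tendsto_of_tendsto_of_tendsto_of_le_of_le tendsto_const_nhds this (fun _ => zero_le)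
    fun n => eLpNorm_add_le (hF n) (hG n) (by simp)

lemma StepData.memLp_toFun (D : StepData) : MemLp D.toFun 2 volume := by
  rw [D.toFun_eq_integral_heaviside]
  exact hasBrownianVariogram_heaviside.memLp_integral D

lemma IsWienerIntegral.add (hW : HasBrownianVariogram P W) (h : IsWienerIntegral P W f I)
    (h' : IsWienerIntegral P W g J) :
    IsWienerIntegral P W (fun s => f s + g s) (fun ω => I ω + J ω) := by
  obtain ⟨hf, hI, D, hDf, hDI⟩ := h
  obtain ⟨hg, hJ, D', hDg, hDJ⟩ := h'
  refine ⟨hf.add hg, hI.add hJ, fun n => (D n).add (D' n), ?_, ?_⟩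
  · refine (tendsto_eLpNorm_add_zero (fun n => ((D n).memLp_toFun.sub hf).1)
      (fun n => ((D' n).memLp_toFun.sub hg).1) hDf hDg).congr fun n => ?_
    congr 1; funext s
    simp only [StepData.toFun_add, Pi.add_apply, Pi.sub_apply]; ring
  · refine (tendsto_eLpNorm_add_zero (fun n => ((hW.memLp_integral (D n)).sub hI).1)
      (fun n => ((hW.memLp_integral (D' n)).sub hJ).1) hDI hDJ).congr fun n => ?_
    congr 1; funext s
    simp only [StepData.integral_add, Pi.add_apply, Pi.sub_apply]; ring

lemma isWienerIntegral_zero : IsWienerIntegral P W (fun _ => 0) (fun _ => 0) := by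
  refine ⟨MemLp.zero, MemLp.zero, fun _ => ⟨0, Fin.elim0, Fin.elim0, Fin.elim0, Fin.rec0⟩, ?_, ?_⟩
  · simp [StepData.toFun]
  · simp [StepData.integral]

lemma IsWienerIntegral.sum (hW : HasBrownianVariogram P W) {ι : Type*} (s : Finset ι)
    {f : ι → ℝ → ℝ} {I : ι → Ω → ℝ} (h : ∀ i ∈ s, IsWienerIntegral P W (f i) (I i)) :
    IsWienerIntegral P W (fun x => ∑ i ∈ s, f i x) (fun ω => ∑ i ∈ s, I i ω) := by
  classical
  induction s using Finset.induction_on with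
  | empty => simpa using isWienerIntegral_zero
  | insert i s hi ih =>
    simp only [Finset.sum_insert hi]
    exact (h i (by simp)).add hW (ih fun j hj => h j (by simp [hj]))

lemma IsWienerIntegral.sub (hW : HasBrownianVariogram P W) (h : IsWienerIntegral P W f I)
    (h' : IsWienerIntegral P W g J) :
    IsWienerIntegral P W (fun s => f s - g s) (fun ω => I ω - J ω) := by
  have := h.add hW (h'.const_mul (-1))
  simpa [sub_eq_add_neg] using this

/-- The Wiener isometry. -/
lemma IsWienerIntegral.eLpNorm_eq (hW : HasBrownianVariogram P W) (h : IsWienerIntegral P W f I) :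
    eLpNorm I 2 P = eLpNorm f 2 volume := by
  obtain ⟨hf, hI, D, hDf, hDI⟩ := h
  have h1 := tendsto_eLpNorm_of_tendsto_eLpNorm_sub (fun n => (D n).memLp_toFun) hf hDf
  have h2 := tendsto_eLpNorm_of_tendsto_eLpNorm_sub (fun n => hW.memLp_integral (D n)) hI hDI
  simp only [hW.eLpNorm_integral] at h2
  exact tendsto_nhds_unique h2 h1

lemma IsWienerIntegral.integral_sq_eq (hW : HasBrownianVariogram P W)
    (h : IsWienerIntegral P W f I) : ∫ ω, I ω ^ 2 ∂P = ∫ s, f s ^ 2 := by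
  have h1 := h.eLpNorm_eq hW
  rw [eLpNorm_two_eq_ofReal h.1, eLpNorm_two_eq_ofReal h.2.1,
    ENNReal.ofReal_eq_ofReal_iff (by positivity) (by positivity)] at h1
  exact (Real.sqrt_inj (integral_nonneg fun _ => sq_nonneg _)
    (integral_nonneg fun _ => sq_nonneg _)).1 h1

lemma IsWienerIntegral.integral_mul_eq (hW : HasBrownianVariogram P W)
    (h : IsWienerIntegral P W f I) (h' : IsWienerIntegral P W g J) :
    ∫ ω, I ω * J ω ∂P = ∫ s, f s * g s := by
  have h1 := (h.add hW h').integral_sq_eq hW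
  rw [integral_add_sq h.2.1 h'.2.1, integral_add_sq h.1 h'.1, h.integral_sq_eq hW,
    h'.integral_sq_eq hW] at h1
  linarith

lemma IsWienerIntegral.ae_eq (hW : HasBrownianVariogram P W)
    (h : IsWienerIntegral P W f I) (h' : IsWienerIntegral P W f J) : I =ᵐ[P] J := by
  have h1 := (h.sub hW h').eLpNorm_eq hW
  have h2 : (fun s => f s - f s) = (0 : ℝ → ℝ) := by funext s; simp
  rw [h2, eLpNorm_zero,
    eLpNorm_eq_zero_iff (f := fun ω => I ω - J ω) (h.2.1.sub h'.2.1).1 (by simp)] at h1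
  filter_upwards [h1] with ω hω
  simpa [sub_eq_zero] using hω

end WienerIntegral

end AlmostAutomorphy

namespace AlmostAutomorphy

/-! ### Wiener integrals are Gaussian -/

variable {Ω : Type*} [MeasurableSpace Ω] {P : Measure Ω} {W : ℝ → Ω → ℝ}

/-- A Brownian motion indexed by the line is Gaussian to the right of any time `A`, after
subtraction of its value at `A`. -/
lemma IsTwoSidedBrownianMotion.isGaussianProcess_sub (hW : IsTwoSidedBrownianMotion P W) (A : ℝ) :
    IsGaussianProcess (fun (t : Ici A) ω => W t ω - W A ω) P := by
  refine HasIndepIncrements.isGaussianProcess (fun t => ?_) ?_ ?_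
  · exact (hW.increment_law A t t.2).hasGaussianLaw
  · refine ae_of_all _ fun ω => ?_
    exact sub_self _
  · intro n t ht
    simpa using hW.indep_increments n (fun i => (t i : ℝ)) fun i j hij => ht hij

lemma IsTwoSidedBrownianMotion.hasGaussianLaw_integral (hW : IsTwoSidedBrownianMotion P W)
    (D : StepData) : HasGaussianLaw (D.integral W) P := by
  classical
  obtain ⟨A, hA⟩ := (finite_range D.a).bddBelow
  have ha : ∀ i, A ≤ D.a i := fun i => hA (mem_range_self i)
  have hb : ∀ i, A ≤ D.b i := fun i => (ha i).trans (D.le i)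
  have h := IsGaussianProcess.of_isGaussianProcess (hW.isGaussianProcess_sub A) (S := Fin D.n)
    (Y := fun i ω => D.c i * (W (D.b i) ω - W (D.a i) ω)) fun i =>
      ⟨{⟨D.a i, ha i⟩, ⟨D.b i, hb i⟩},
        D.c i • (ContinuousLinearMap.proj ⟨⟨D.b i, hb i⟩, by simp⟩
          - ContinuousLinearMap.proj ⟨⟨D.a i, ha i⟩, by simp⟩), fun ω => by simp⟩
  have h2 := h.hasGaussianLaw_fun_sum (I := Finset.univ)
  exact h2

lemma IsTwoSidedBrownianMotion.integral_stepData_eq_zero [IsProbabilityMeasure P]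
    (hW : IsTwoSidedBrownianMotion P W) (D : StepData) : ∫ ω, D.integral W ω ∂P = 0 := by
  simp only [StepData.integral]
  rw [integral_finsetSum _ fun i _ =>
    ((hasBrownianVariogram_of_isTwoSidedBrownianMotion hW _ _).1.integrable
      (by simp)).const_mul _]
  refine Finset.sum_eq_zero fun i _ => ?_
  have h1 := hW.increment_law (D.a i) (D.b i) (D.le i)
  have h2 : ∫ ω, W (D.b i) ω - W (D.a i) ω ∂P = 0 := by
    have := h1.integral_eq
    simpa using this
  rw [integral_const_mul, h2, mul_zero]

/-- Centred Gaussian variables are closed under limits in `L²`: along an almost surely convergent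
subsequence the characteristic functions converge, and so do the variances. -/
lemma hasLaw_gaussianReal_of_tendsto [IsProbabilityMeasure P] {X : ℕ → Ω → ℝ} {Y : Ω → ℝ}
    (hX : ∀ n, HasGaussianLaw (X n) P) (hX0 : ∀ n, ∫ ω, X n ω ∂P = 0) (hY : MemLp Y 2 P)
    (h : Tendsto (fun n => eLpNorm (fun ω => X n ω - Y ω) 2 P) atTop (𝓝 0)) :
    HasLaw Y (gaussianReal 0 (∫ ω, Y ω ^ 2 ∂P).toNNReal) P := by
  have hX2 : ∀ n, MemLp (X n) 2 P := fun n => (hX n).memLp_two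
  have hvar : Tendsto (fun n => ∫ ω, X n ω ^ 2 ∂P) atTop (𝓝 (∫ ω, Y ω ^ 2 ∂P)) := by
    have h1 := tendsto_eLpNorm_of_tendsto_eLpNorm_sub hX2 hY h
    have h2 := ((ENNReal.tendsto_toReal hY.2.ne).comp h1).pow 2
    have h3 : ∀ Z : Ω → ℝ, MemLp Z 2 P → (eLpNorm Z 2 P).toReal ^ 2 = ∫ ω, Z ω ^ 2 ∂P := by
      intro Z hZ
      rw [eLpNorm_two_eq_ofReal hZ, ENNReal.toReal_ofReal (Real.sqrt_nonneg _),
        Real.sq_sqrt (integral_nonneg fun _ => sq_nonneg _)]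
    rw [h3 Y hY] at h2
    exact h2.congr fun n => h3 _ (hX2 n)
  obtain ⟨ns, hns, hae⟩ := (tendstoInMeasure_of_tendsto_eLpNorm (by simp) (fun n => (hX2 n).1)
    hY.1 h).exists_seq_tendsto_ae
  have hlaw : ∀ n, P.map (X n) = gaussianReal 0 (∫ ω, X n ω ^ 2 ∂P).toNNReal := by
    intro n
    rw [(hX n).map_eq_gaussianReal, hX0,
      variance_of_integral_eq_zero (hX n).aemeasurable (hX0 n)]
  refine ⟨hY.1.aemeasurable, ?_⟩
  have : IsProbabilityMeasure (P.map Y) := Measure.isProbabilityMeasure_map hY.1.aemeasurable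
  refine Measure.ext_of_charFun (funext fun u => ?_)
  have hcf : ∀ Z : Ω → ℝ, AEMeasurable Z P →
      charFun (P.map Z) u = ∫ ω, Complex.exp (u * Z ω * Complex.I) ∂P := by
    intro Z hZ
    rw [charFun_apply_real, integral_map hZ (by fun_prop)]
  have h1 : Tendsto (fun n => charFun (P.map (X (ns n))) u) atTop (𝓝 (charFun (P.map Y) u)) := by
    rw [hcf Y hY.1.aemeasurable]
    simp only [fun n => hcf (X n) (hX n).aemeasurable]
    refine tendsto_integral_of_dominated_convergence (fun _ => 1) (fun n => ?_)
      (integrable_const 1) (fun n => ae_of_all _ fun ω => ?_) ?_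
    · have := (hX (ns n)).aemeasurable
      exact (by fun_prop : AEMeasurable _ P).aestronglyMeasurable
    · rw [← Complex.ofReal_mul, Complex.norm_exp_ofReal_mul_I]
    · filter_upwards [hae] with ω hω
      have hc : Continuous fun x : ℝ => Complex.exp (u * x * Complex.I) := by fun_prop
      exact (hc.tendsto _).comp hω
  have h2 : Tendsto (fun n => charFun (P.map (X (ns n))) u) atTop
      (𝓝 (charFun (gaussianReal 0 (∫ ω, Y ω ^ 2 ∂P).toNNReal) u)) := by
    simp only [hlaw, charFun_gaussianReal]
    have hc : Continuous fun x : ℝ =>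
        Complex.exp (u * (0 : ℝ) * Complex.I - (x.toNNReal : ℝ) * u ^ 2 / 2) := by fun_prop
    exact (hc.tendsto _).comp (hvar.comp hns.tendsto_atTop)
  exact tendsto_nhds_unique h1 h2

lemma IsWienerIntegral.hasLaw [IsProbabilityMeasure P] (hW : IsTwoSidedBrownianMotion P W)
    {f : ℝ → ℝ} {I : Ω → ℝ} (h : IsWienerIntegral P W f I) :
    HasLaw I (gaussianReal 0 (∫ ω, I ω ^ 2 ∂P).toNNReal) P := by
  obtain ⟨-, hI, D, -, hDI⟩ := h
  exact hasLaw_gaussianReal_of_tendsto (fun n => hW.hasGaussianLaw_integral (D n))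
    (fun n => hW.integral_stepData_eq_zero (D n)) hI hDI

lemma IsWienerIntegral.integral_eq_zero [IsProbabilityMeasure P]
    (hW : IsTwoSidedBrownianMotion P W) {f : ℝ → ℝ} {I : Ω → ℝ} (h : IsWienerIntegral P W f I) :
    ∫ ω, I ω ∂P = 0 := by
  have := (h.hasLaw hW).integral_eq
  simpa using this

/-- Wiener integrals of a family of functions form a Gaussian process, since their linear
combinations are Wiener integrals again. -/
lemma isGaussianProcess_of_isWienerIntegral [IsProbabilityMeasure P]
    (hW : IsTwoSidedBrownianMotion P W) {T : Type*} {f : T → ℝ → ℝ} {X : T → Ω → ℝ}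
    (h : ∀ t, IsWienerIntegral P W (f t) (X t)) : IsGaussianProcess X P := by
  classical
  refine ⟨fun J => ⟨isGaussian_of_map_eq_gaussianReal fun L => ?_⟩⟩
  have hm : AEMeasurable (fun ω => J.restrict (X · ω)) P :=
    aemeasurable_pi_lambda _ fun i => (h i).2.1.1.aemeasurable
  have h1 := IsWienerIntegral.sum (hasBrownianVariogram_of_isTwoSidedBrownianMotion hW)
    (Finset.univ : Finset J) fun i _ => (h i).const_mul (L (Pi.single i 1))
  have h2 : (L ∘ fun ω => J.restrict (X · ω)) =
      fun ω => ∑ i : J, L (Pi.single i 1) * X i ω := by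
    funext ω
    simp only [Function.comp_apply]
    conv_lhs => rw [pi_eq_sum_univ' (J.restrict (X · ω))]
    simp [map_sum, mul_comm]
  rw [AEMeasurable.map_map_of_aemeasurable L.continuous.measurable.aemeasurable hm, h2]
  exact ⟨_, _, (h1.hasLaw hW).map_eq⟩

end AlmostAutomorphy

namespace AlmostAutomorphy

/-! ### The exponential law -/

lemma ae_nonneg_expMeasure (α : ℝ) : ∀ᵐ u ∂expMeasure α, 0 ≤ u := by
  rw [expMeasure, gammaMeasure,
    ae_withDensity_iff (f := gammaPDF 1 α) (measurable_gammaPDFReal 1 α).ennreal_ofReal]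
  refine ae_of_all _ fun u hu => ?_
  by_contra! h
  exact hu (exponentialPDF_of_neg h)

lemma expMeasure_eq_withDensity (α : ℝ) : expMeasure α =
    (volume.restrict (Ici 0)).withDensity fun u => ENNReal.ofReal (α * Real.exp (-(α * u))) := by
  rw [expMeasure, gammaMeasure, ← withDensity_indicator measurableSet_Ici]
  congr 1
  funext u
  by_cases hu : 0 ≤ u
  · rw [indicator_of_mem (by exact hu)]
    exact exponentialPDF_of_nonneg hu
  · rw [indicator_of_notMem (by exact hu)]
    exact exponentialPDF_of_neg (not_le.1 hu)

lemma nullSingletonClass_expMeasure (α : ℝ) : NullSingletonClass (expMeasure α) := by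
  rw [expMeasure_eq_withDensity]
  infer_instance

lemma integrable_expMeasure_iff {α : ℝ} (hα : 0 < α) (g : ℝ → ℝ) :
    Integrable g (expMeasure α) ↔
      IntegrableOn (fun u => α * Real.exp (-(α * u)) * g u) (Ici 0) := by
  rw [expMeasure_eq_withDensity, integrable_withDensity_iff_integrable_smul' (by fun_prop) (by simp)]
  refine integrable_congr (ae_of_all _ fun u => ?_)
  simp only [smul_eq_mul]
  rw [ENNReal.toReal_ofReal (by positivity)]

lemma integral_expMeasure {α : ℝ} (hα : 0 < α) (g : ℝ → ℝ) :
    ∫ u, g u ∂expMeasure α = ∫ u in Ici 0, α * Real.exp (-(α * u)) * g u := by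
  rw [expMeasure_eq_withDensity, integral_withDensity_eq_integral_toReal_smul (by fun_prop) (by simp)]
  refine integral_congr_ae (ae_of_all _ fun u => ?_)
  simp only [smul_eq_mul]
  rw [ENNReal.toReal_ofReal (by positivity)]

lemma integrable_id_expMeasure {α : ℝ} (hα : 0 < α) : Integrable (fun u => u) (expMeasure α) := by
  rw [integrable_expMeasure_iff hα, integrableOn_Ici_iff_integrableOn_Ioi]
  have h := (integrableOn_rpow_mul_exp_neg_mul_rpow (s := 1) (p := 1) (b := α) (by norm_num)
    one_pos hα).const_mul α
  refine h.congr (ae_of_all _ fun u => ?_)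
  simp only [Real.rpow_one, neg_mul]
  ring

lemma expMeasure_real_Ici {α : ℝ} (hα : 0 < α) {x : ℝ} (hx : 0 ≤ x) :
    (expMeasure α).real (Ici x) = Real.exp (-(α * x)) := by
  have hp := isProbabilityMeasure_expMeasure hα
  have h1 : (expMeasure α).real (Iio x) = 1 - Real.exp (-(α * x)) := by
    have hIio : (expMeasure α) (Iio x) = (expMeasure α) (Iic x) := by
      refine measure_congr ?_
      have := nullSingletonClass_expMeasure α
      exact Iio_ae_eq_Iic
    rw [measureReal_def, hIio, ← measureReal_def, ← cdf_eq_real, cdf_expMeasure_eq hα, if_pos hx]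
  rw [← compl_Iio, probReal_compl_eq_one_sub measurableSet_Iio, h1]
  ring

/-! ### Exponential mixtures of increments as Wiener integrals -/

/-- `Z(t)` minus the exponentially weighted average of the past of `Z`. For Brownian motion this is
the Wiener integral of `s ↦ e^{-α (t - s)}` over `(-∞, t]`, after an integration by parts. -/
noncomputable def pastDeviation {S : Type*} (α : ℝ) (Z : ℝ → S → ℝ) (t : ℝ) (s : S) : ℝ :=
  ∫ u, (Z t s - Z (t - u) s) ∂expMeasure α

lemma pastDeviation_heaviside {α : ℝ} (hα : 0 < α) (t s : ℝ) :
    pastDeviation α heaviside t s = (Iic t).indicator (fun s => Real.exp (-α * (t - s))) s := by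
  have hp := isProbabilityMeasure_expMeasure hα
  by_cases hs : s ≤ t
  · rw [indicator_of_mem (by exact hs)]
    have h1 : (fun u => heaviside t s - heaviside (t - u) s) = (Ioi (t - s)).indicator 1 := by
      funext u
      simp only [heaviside, indicator, mem_Iic, mem_Ioi, Pi.one_apply, hs, if_true]
      split_ifs <;> linarith
    have h2 : (expMeasure α).real (Ioi (t - s)) = (expMeasure α).real (Ici (t - s)) := by
      have := nullSingletonClass_expMeasure α
      rw [measureReal_def, measureReal_def, measure_congr Ioi_ae_eq_Ici]
    rw [pastDeviation, h1, integral_indicator_one measurableSet_Ioi, h2,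
      expMeasure_real_Ici hα (by linarith)]
    ring_nf
  · rw [indicator_of_notMem (by exact hs), pastDeviation]
    refine integral_eq_zero_of_ae ?_
    filter_upwards [ae_nonneg_expMeasure α] with u hu
    have h1 : ¬ s ≤ t - u := by linarith
    simp [heaviside, hs, h1]

/-- Nonnegative simple functions which converge in mean to the identity with respect to the
exponential law. -/
lemma exists_simpleFunc_tendsto_id {α : ℝ} (hα : 0 < α) : ∃ ρ : ℕ → SimpleFunc ℝ ℝ,
    (∀ n u, 0 ≤ ρ n u) ∧
      Tendsto (fun n => ∫⁻ u, ‖ρ n u - u‖ₑ ∂expMeasure α) atTop (𝓝 0) := by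
  refine ⟨SimpleFunc.approxOn id measurable_id (Ici 0) 0 self_mem_Ici, fun n u =>
    SimpleFunc.approxOn_mem measurable_id self_mem_Ici n u, ?_⟩
  refine SimpleFunc.tendsto_approxOn_L1_enorm measurable_id self_mem_Ici ?_ ?_
  · filter_upwards [ae_nonneg_expMeasure α] with u hu
    exact subset_closure hu
  · simpa using (integrable_id_expMeasure hα).2

/-- The intervals `(t - y, t]`, weighted with the probability that `ρ` takes the value `y`. -/
noncomputable def mixtureStepData (α t : ℝ) (ρ : SimpleFunc ℝ ℝ) (hρ : ∀ u, 0 ≤ ρ u) : StepData where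
  n := ρ.range.card
  a := fun i => t - (ρ.range.equivFin.symm i : ℝ)
  b := fun _ => t
  c := fun i => (expMeasure α).real (ρ ⁻¹' {(ρ.range.equivFin.symm i : ℝ)})
  le := fun i => by
    obtain ⟨u, hu⟩ := SimpleFunc.mem_range.1 (ρ.range.equivFin.symm i).2
    rw [← hu]
    linarith [hρ u]

lemma integral_mixtureStepData {S : Type*} {α : ℝ} (hα : 0 < α) (t : ℝ) (ρ : SimpleFunc ℝ ℝ)
    (hρ : ∀ u, 0 ≤ ρ u) (Z : ℝ → S → ℝ) (s : S) :
    (mixtureStepData α t ρ hρ).integral Z s = ∫ u, (Z t s - Z (t - ρ u) s) ∂expMeasure α := by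
  have hp := isProbabilityMeasure_expMeasure hα
  have h2 : ∫ u, (Z t s - Z (t - ρ u) s) ∂expMeasure α =
      ∑ y ∈ ρ.range, (expMeasure α).real (ρ ⁻¹' {y}) * (Z t s - Z (t - y) s) := by
    have h3 : ∀ u, Z t s - Z (t - ρ u) s =
        ∑ y ∈ ρ.range, (ρ ⁻¹' {y}).indicator (fun _ => Z t s - Z (t - y) s) u := by
      intro u
      rw [Finset.sum_eq_single (ρ u)]
      · simp
      · intro y _ hy
        exact indicator_of_notMem (fun h => hy (by simpa using h.symm)) _
      · exact fun h => absurd (ρ.mem_range_self u) h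
    simp only [h3]
    rw [integral_finsetSum _ fun y _ =>
      (integrable_const _).indicator (ρ.measurableSet_preimage _)]
    refine Finset.sum_congr rfl fun y _ => ?_
    rw [integral_indicator_const _ (ρ.measurableSet_preimage _), smul_eq_mul]
  rw [h2, ← Finset.sum_coe_sort]
  exact Fintype.sum_equiv ρ.range.equivFin.symm _ _ fun i => rfl

section Mixture

variable {S : Type*} [MeasurableSpace S] {Q : Measure S} {Z : ℝ → S → ℝ}

lemma HasBrownianVariogram.lintegral_enorm_sq (hZ : HasBrownianVariogram Q Z) (x y : ℝ) :
    ∫⁻ s, ‖Z x s - Z y s‖ₑ ^ 2 ∂Q = ‖x - y‖ₑ := by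
  have h1 := ofReal_integral_eq_lintegral_ofReal (hZ x y).1.integrable_sq
    (ae_of_all _ fun s => sq_nonneg _)
  rw [(hZ x y).2] at h1
  rw [← ofReal_norm (x - y), Real.norm_eq_abs, h1]
  refine lintegral_congr fun s => ?_
  rw [← ofReal_norm, ← ENNReal.ofReal_pow (norm_nonneg _), Real.norm_eq_abs, sq_abs]

variable [SFinite Q]

/-- For almost every `s` the mixture which defines `pastDeviation α Z t s` is integrable. -/
lemma HasBrownianVariogram.ae_integrable (hZ : HasBrownianVariogram Q Z)
    (hm : Measurable (Function.uncurry Z)) {α : ℝ} (hα : 0 < α) (t : ℝ) :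
    ∀ᵐ s ∂Q, Integrable (fun u => Z t s - Z (t - u) s) (expMeasure α) := by
  have hp := isProbabilityMeasure_expMeasure hα
  have hmeas : Measurable (Function.uncurry fun (s : S) (u : ℝ) => Z t s - Z (t - u) s) :=
    (hm.comp (by fun_prop : Measurable fun p : S × ℝ => (t, p.1))).sub
      (hm.comp (by fun_prop : Measurable fun p : S × ℝ => (t - p.2, p.1)))
  have h1 : ∫⁻ s, ∫⁻ u, ‖Z t s - Z (t - u) s‖ₑ ^ 2 ∂expMeasure α ∂Q < ∞ := by
    rw [lintegral_lintegral_swap (by exact (hmeas.enorm.pow_const 2).aemeasurable)]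
    simp only [hZ.lintegral_enorm_sq, sub_sub_cancel]
    exact (integrable_id_expMeasure hα).2
  have h2 : Measurable fun s => ∫⁻ u, ‖Z t s - Z (t - u) s‖ₑ ^ 2 ∂expMeasure α :=
    Measurable.lintegral_prod_right (hmeas.enorm.pow_const 2)
  filter_upwards [ae_lt_top h2 h1.ne] with s hs
  have hsm : AEStronglyMeasurable (fun u => Z t s - Z (t - u) s) (expMeasure α) :=
    (hmeas.comp measurable_prodMk_left).aestronglyMeasurable
  refine MemLp.integrable (q := 2) (by simp) ⟨hsm, ?_⟩
  rw [eLpNorm_lt_top_iff_lintegral_rpow_enorm_lt_top (by simp) (by simp)]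
  simpa using hs

/-- Replacing the exponential variable `u` in the mixture by a simple function `ρ` of it costs at
most `∫ |ρ u - u|` in mean square, by Jensen's inequality and Tonelli's theorem. -/
lemma HasBrownianVariogram.lintegral_mixture_sub_le (hZ : HasBrownianVariogram Q Z)
    (hm : Measurable (Function.uncurry Z)) {α : ℝ} (hα : 0 < α) (t : ℝ) (ρ : SimpleFunc ℝ ℝ)
    (hρ : ∀ u, 0 ≤ ρ u) :
    ∫⁻ s, ‖(mixtureStepData α t ρ hρ).integral Z s - pastDeviation α Z t s‖ₑ ^ 2 ∂Q
      ≤ ∫⁻ u, ‖ρ u - u‖ₑ ∂expMeasure α := by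
  have hp := isProbabilityMeasure_expMeasure hα
  have hmeas : Measurable (Function.uncurry fun (s : S) (u : ℝ) => Z (t - u) s - Z (t - ρ u) s) :=
    (hm.comp (by fun_prop : Measurable fun p : S × ℝ => (t - p.2, p.1))).sub
      (hm.comp (Measurable.prodMk (measurable_const.sub (ρ.measurable.comp measurable_snd))
        measurable_fst))
  calc _ ≤ ∫⁻ s, ∫⁻ u, ‖Z (t - u) s - Z (t - ρ u) s‖ₑ ^ 2 ∂expMeasure α ∂Q := by
        refine lintegral_mono_ae ?_
        filter_upwards [hZ.ae_integrable hm hα t] with s hs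
        have hs' : Integrable (fun u => Z t s - Z (t - ρ u) s) (expMeasure α) := by
          have : (fun u => Z t s - Z (t - ρ u) s) = ρ.map fun y => Z t s - Z (t - y) s := by
            funext u; simp
          rw [this]
          exact SimpleFunc.integrable_of_isFiniteMeasure _
        rw [integral_mixtureStepData hα, pastDeviation, ← integral_sub hs' hs]
        simp only [sub_sub_sub_cancel_left]
        have hsm : AEStronglyMeasurable (fun u => Z (t - u) s - Z (t - ρ u) s) (expMeasure α) :=
          (hmeas.comp measurable_prodMk_left).aestronglyMeasurable
        have h1 := eLpNorm_le_eLpNorm_of_exponent_le (p := 1) (q := 2) (by simp) hsm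
        rw [eLpNorm_one_eq_lintegral_enorm,
          eLpNorm_eq_lintegral_rpow_enorm_toReal (by simp) (by simp)] at h1
        calc _ ≤ (∫⁻ u, ‖Z (t - u) s - Z (t - ρ u) s‖ₑ ∂expMeasure α) ^ 2 := by
              gcongr
              exact enorm_integral_le_lintegral_enorm _
          _ ≤ _ := by
              refine (pow_le_pow_left' h1 2).trans (le_of_eq ?_)
              rw [← ENNReal.rpow_natCast, ← ENNReal.rpow_mul]
              simp
    _ = ∫⁻ u, ∫⁻ s, ‖Z (t - u) s - Z (t - ρ u) s‖ₑ ^ 2 ∂Q ∂expMeasure α :=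
        lintegral_lintegral_swap (by exact (hmeas.enorm.pow_const 2).aemeasurable)
    _ = _ := by simp only [hZ.lintegral_enorm_sq, sub_sub_sub_cancel_left]

lemma HasBrownianVariogram.tendsto_mixture (hZ : HasBrownianVariogram Q Z)
    (hm : Measurable (Function.uncurry Z)) {α : ℝ} (hα : 0 < α) (t : ℝ)
    {ρ : ℕ → SimpleFunc ℝ ℝ} (hρ : ∀ n u, 0 ≤ ρ n u)
    (hlim : Tendsto (fun n => ∫⁻ u, ‖ρ n u - u‖ₑ ∂expMeasure α) atTop (𝓝 0)) :
    Tendsto (fun n => eLpNorm (fun s => (mixtureStepData α t (ρ n) (hρ n)).integral Z s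
      - pastDeviation α Z t s) 2 Q) atTop (𝓝 0) := by
  have h1 := (ENNReal.continuous_rpow_const (y := 1 / 2)).tendsto 0 |>.comp hlim
  rw [ENNReal.zero_rpow_of_pos (by norm_num)] at h1
  refine tendsto_of_tendsto_of_tendsto_of_le_of_le tendsto_const_nhds h1 (fun _ => zero_le)
    fun n => ?_
  rw [eLpNorm_eq_lintegral_rpow_enorm_toReal (by simp) (by simp)]
  simp only [Function.comp_apply, ENNReal.toReal_ofNat]
  gcongr
  simpa using hZ.lintegral_mixture_sub_le hm hα t (ρ n) (hρ n)

lemma HasBrownianVariogram.memLp_pastDeviation (hZ : HasBrownianVariogram Q Z)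
    (hm : Measurable (Function.uncurry Z)) {α : ℝ} (hα : 0 < α) (t : ℝ) :
    MemLp (pastDeviation α Z t) 2 Q := by
  have hp := isProbabilityMeasure_expMeasure hα
  have hmeas : Measurable (Function.uncurry fun (s : S) (u : ℝ) => Z t s - Z (t - u) s) :=
    (hm.comp (by fun_prop : Measurable fun p : S × ℝ => (t, p.1))).sub
      (hm.comp (by fun_prop : Measurable fun p : S × ℝ => (t - p.2, p.1)))
  have hsm : StronglyMeasurable (pastDeviation α Z t) :=
    hmeas.stronglyMeasurable.integral_prod_right
  obtain ⟨ρ, hρ, hlim⟩ := exists_simpleFunc_tendsto_id hα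
  obtain ⟨n, hn⟩ := ((hZ.tendsto_mixture hm hα t hρ hlim).eventually
    (gt_mem_nhds ENNReal.zero_lt_top)).exists
  have h1 := hZ.memLp_integral (mixtureStepData α t (ρ n) (hρ n))
  have h2 : MemLp (fun s => (mixtureStepData α t (ρ n) (hρ n)).integral Z s
      - pastDeviation α Z t s) 2 Q := ⟨h1.1.sub hsm.aestronglyMeasurable, hn⟩
  refine (h1.sub h2).ae_eq (ae_of_all _ fun s => ?_)
  simp

end Mixture

lemma measurable_uncurry_heaviside : Measurable (Function.uncurry heaviside) := by
  have h1 : Function.uncurry heaviside = {p : ℝ × ℝ | p.2 ≤ p.1}.indicator fun _ => 1 := by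
    funext p
    simp [Function.uncurry, heaviside, indicator]
  rw [h1]
  exact measurable_const.indicator (measurableSet_le measurable_snd measurable_fst)

/-- The Wiener integral of the Ornstein-Uhlenbeck kernel, with approximating step functions which
vanish on `(t, ∞)`. -/
theorem exists_stepData_tendsto_pastDeviation {Ω : Type*} [MeasurableSpace Ω] {P : Measure Ω}
    [SFinite P] {W : ℝ → Ω → ℝ} (hW : HasBrownianVariogram P W)
    (hm : Measurable (Function.uncurry W)) {α : ℝ} (hα : 0 < α) (t : ℝ) :
    MemLp ((Iic t).indicator fun s => Real.exp (-α * (t - s))) 2 volume ∧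
    MemLp (pastDeviation α W t) 2 P ∧
    ∃ D : ℕ → StepData, (∀ n i, (D n).b i ≤ t) ∧
      Tendsto (fun n => eLpNorm (fun s => (D n).toFun s
        - (Iic t).indicator (fun s => Real.exp (-α * (t - s))) s) 2 volume) atTop (𝓝 0) ∧
      Tendsto (fun n => eLpNorm (fun ω => (D n).integral W ω - pastDeviation α W t ω) 2 P)
        atTop (𝓝 0) := by
  obtain ⟨ρ, hρ, hlim⟩ := exists_simpleFunc_tendsto_id hα
  have hH : pastDeviation α heaviside t = (Iic t).indicator fun s => Real.exp (-α * (t - s)) :=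
    funext (pastDeviation_heaviside hα t)
  rw [← hH]
  refine ⟨hasBrownianVariogram_heaviside.memLp_pastDeviation measurable_uncurry_heaviside hα t,
    hW.memLp_pastDeviation hm hα t, fun n => mixtureStepData α t (ρ n) (hρ n),
    fun n i => le_rfl, ?_, hW.tendsto_mixture hm hα t hρ hlim⟩
  simp only [StepData.toFun_eq_integral_heaviside]
  exact hasBrownianVariogram_heaviside.tendsto_mixture measurable_uncurry_heaviside hα t hρ hlim

end AlmostAutomorphy

namespace AlmostAutomorphy

/-! ### The equation along a single path -/

section Path

variable {α : ℝ} {v : ℝ → ℝ}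

lemma setIntegral_Ici_exp_mul_comp_sub (α : ℝ) (v : ℝ → ℝ) (t : ℝ) :
    ∫ u in Ici 0, α * Real.exp (-(α * u)) * v (t - u)
      = α * Real.exp (-(α * t)) * ∫ s in Iic t, Real.exp (α * s) * v s := by
  have h1 := (Measure.measurePreserving_sub_left (volume : Measure ℝ) t).setIntegral_preimage_emb
    (Homeomorph.subLeft t).measurableEmbedding
    (fun s => α * Real.exp (-(α * t)) * (Real.exp (α * s) * v s)) (Iic t)
  have h2 : (fun u => t - u) ⁻¹' Iic t = Ici 0 := by ext u; simp
  rw [h2] at h1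
  rw [← integral_const_mul, ← h1]
  refine setIntegral_congr_fun measurableSet_Ici fun u _ => ?_
  have h3 : Real.exp (-(α * u)) = Real.exp (-(α * t)) * Real.exp (α * (t - u)) := by
    rw [← Real.exp_add]; ring_nf
  rw [h3]
  ring

lemma integrableOn_Ici_exp_mul_comp_sub_iff (hα : 0 < α) (v : ℝ → ℝ) (t : ℝ) :
    IntegrableOn (fun u => α * Real.exp (-(α * u)) * v (t - u)) (Ici 0) ↔
      IntegrableOn (fun s => Real.exp (α * s) * v s) (Iic t) := by
  have h1 := (Measure.measurePreserving_sub_left (volume : Measure ℝ) t).integrableOn_comp_preimage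
    (Homeomorph.subLeft t).measurableEmbedding
    (f := fun s => α * Real.exp (-(α * t)) * (Real.exp (α * s) * v s)) (s := Iic t)
  have h2 : (fun u => t - u) ⁻¹' Iic t = Ici 0 := by ext u; simp
  have h3 : ((fun s => α * Real.exp (-(α * t)) * (Real.exp (α * s) * v s)) ∘ fun u => t - u)
      = fun u => α * Real.exp (-(α * u)) * v (t - u) := by
    funext u
    simp only [Function.comp_apply]
    rw [← mul_assoc, mul_assoc α, ← Real.exp_add]
    ring_nf
  rw [h2, h3] at h1
  rw [h1, IntegrableOn, integrable_const_mul_iff (IsUnit.mk0 _ (by positivity)), IntegrableOn]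

/-- The weighted past `G(t) = α e^{-αt} ∫_{-∞}^t e^{αs} v(s) ds` of a path `v` solves
`G' = α (v - G)`. -/
lemma hasDerivAt_weightedPast (hv : Continuous v)
    (hint : IntegrableOn (fun s => Real.exp (α * s) * v s) (Iic 0)) (t : ℝ) :
    HasDerivAt (fun t => α * Real.exp (-(α * t)) * ∫ s in Iic t, Real.exp (α * s) * v s)
      (α * (v t - α * Real.exp (-(α * t)) * ∫ s in Iic t, Real.exp (α * s) * v s)) t := by
  have hc : Continuous fun s => Real.exp (α * s) * v s := by fun_prop
  have hintt : ∀ t, IntegrableOn (fun s => Real.exp (α * s) * v s) (Iic t) := fun t =>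
    ((hint.union (hc.integrableOn_Icc (a := 0) (b := t)))).mono_set fun s hs => by
      rcases le_total s 0 with h | h
      · exact Or.inl h
      · exact Or.inr ⟨h, hs⟩
  have hF : HasDerivAt (fun t => ∫ s in Iic t, Real.exp (α * s) * v s)
      (Real.exp (α * t) * v t) t := by
    have h1 : (fun t => ∫ s in Iic t, Real.exp (α * s) * v s) =
        fun t => (∫ s in Iic 0, Real.exp (α * s) * v s) + ∫ s in (0 : ℝ)..t,
          Real.exp (α * s) * v s := by
      funext t
      rw [← intervalIntegral.integral_Iic_sub_Iic (hintt 0) (hintt t)]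
      ring
    rw [h1]
    exact (intervalIntegral.integral_hasDerivAt_right (hc.intervalIntegrable _ _)
      hc.aestronglyMeasurable.stronglyMeasurableAtFilter hc.continuousAt).const_add _
  have hE : HasDerivAt (fun t => α * Real.exp (-(α * t)))
      (α * (Real.exp (-(α * t)) * -α)) t := by
    have : HasDerivAt (fun t => -(α * t)) (-α) t := by
      simpa [Pi.neg_def] using ((hasDerivAt_id t).const_mul α).neg
    exact this.exp.const_mul α
  refine (hE.mul hF).congr_deriv ?_
  have : Real.exp (-(α * t)) * Real.exp (α * t) = 1 := by rw [← Real.exp_add]; simp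
  linear_combination α * v t * this

variable {S : Type*} {Z : ℝ → S → ℝ} {s : S}

/-- The path `t ↦ pastDeviation α Z t s` is continuous and solves the integrated equation. -/
lemma pastDeviation_equation (hα : 0 < α) (hc : Continuous fun t => Z t s)
    (hint : Integrable (fun u => Z 0 s - Z (0 - u) s) (expMeasure α)) :
    Continuous (fun t => pastDeviation α Z t s) ∧ ∀ a b : ℝ,
      pastDeviation α Z b s - pastDeviation α Z a s
        = (∫ x in a..b, -α * pastDeviation α Z x s) + (Z b s - Z a s) := by
  have hp := isProbabilityMeasure_expMeasure hα
  set v : ℝ → ℝ := fun t => Z t s - Z 0 s with hv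
  have hvc : Continuous v := by fun_prop
  have h0 : IntegrableOn (fun x => Real.exp (α * x) * v x) (Iic 0) := by
    rw [← integrableOn_Ici_exp_mul_comp_sub_iff hα, ← integrable_expMeasure_iff hα]
    simpa [hv, Pi.neg_def] using hint.neg
  set G : ℝ → ℝ := fun t => α * Real.exp (-(α * t)) * ∫ x in Iic t, Real.exp (α * x) * v x with hG
  have hGd : ∀ t, HasDerivAt G (α * (v t - G t)) t := hasDerivAt_weightedPast hvc h0
  have hcexp : Continuous fun x => Real.exp (α * x) * v x := by fun_prop
  have hintt : ∀ t, Integrable (fun u => v (t - u)) (expMeasure α) := fun t => by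
    rw [integrable_expMeasure_iff hα, integrableOn_Ici_exp_mul_comp_sub_iff hα]
    refine ((h0.union (hcexp.integrableOn_Icc (a := 0) (b := t)))).mono_set fun s hs => ?_
    rcases le_total s 0 with h | h
    · exact Or.inl h
    · exact Or.inr ⟨h, hs⟩
  have hY : ∀ t, pastDeviation α Z t s = v t - G t := by
    intro t
    have h1 : (fun u => Z t s - Z (t - u) s) = fun u => v t - v (t - u) := by
      funext u; simp [hv]
    rw [pastDeviation, h1, integral_sub (integrable_const _) (hintt t), integral_const,
      integral_expMeasure hα, setIntegral_Ici_exp_mul_comp_sub]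
    simp [hG]
  have hGc : Continuous G := continuous_iff_continuousAt.2 fun t => (hGd t).continuousAt
  simp only [hY]
  refine ⟨hvc.sub hGc, fun a b => ?_⟩
  have h2 := intervalIntegral.integral_eq_sub_of_hasDerivAt (fun t _ => hGd t)
    ((continuous_const.mul (hvc.sub hGc)).intervalIntegrable a b)
  simp only [neg_mul, intervalIntegral.integral_neg]
  rw [h2]
  simp only [hv]
  ring

end Path

/-! ### Existence of the Ornstein-Uhlenbeck process -/

variable {Ω : Type*} [MeasurableSpace Ω] {P : Measure Ω} {W : ℝ → Ω → ℝ}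

lemma IsTwoSidedBrownianMotion.aemeasurable (hW : IsTwoSidedBrownianMotion P W) (t : ℝ) :
    AEMeasurable (W t) P := by
  rcases le_total 0 t with h | h
  · refine (hW.increment_law 0 t h).aemeasurable.congr ?_
    filter_upwards [hW.zero] with ω hω
    simp [hω]
  · refine (hW.increment_law t 0 h).aemeasurable.neg.congr ?_
    filter_upwards [hW.zero] with ω hω
    simp [hω]

/-- A process with almost surely continuous paths is indistinguishable from a jointly measurable
one all of whose paths are continuous. -/
lemma exists_continuous_modification {X : ℝ → Ω → ℝ} (hX : ∀ t, AEMeasurable (X t) P)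
    (hc : ∀ᵐ ω ∂P, Continuous fun t => X t ω) :
    ∃ Y : ℝ → Ω → ℝ, (∀ ω, Continuous fun t => Y t ω) ∧ Measurable (Function.uncurry Y) ∧
      ∀ᵐ ω ∂P, ∀ t, X t ω = Y t ω := by
  have h1 : ∀ᵐ ω ∂P, (Continuous fun t => X t ω) ∧ ∀ q : ℚ, X q ω = (hX q).mk (X q) ω := by
    filter_upwards [hc, ae_all_iff.2 fun q : ℚ => (hX q).ae_eq_mk] with ω h h' using ⟨h, h'⟩
  obtain ⟨A, hA, hAm, hAp⟩ := h1.exists_measurable_mem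
  have hcont : ∀ ω, Continuous fun t => A.indicator (X t) ω := by
    intro ω
    by_cases hω : ω ∈ A
    · simpa [hω] using (hAp ω hω).1
    · simpa [hω] using continuous_const
  refine ⟨fun t => A.indicator (X t), hcont, ?_, ?_⟩
  · refine measurable_uncurry_of_continuous_of_measurable hcont fun t => ?_
    obtain ⟨q, hq⟩ := mem_closure_iff_seq_limit.1 (Rat.denseRange_cast (𝕜 := ℝ) t)
    choose r hr using hq.1
    refine measurable_of_tendsto_metrizable (f := fun n => A.indicator (X (q n))) (fun n => ?_) ?_
    · have : A.indicator (X (q n)) = A.indicator ((hX (r n)).mk (X (r n))) := by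
        funext ω
        by_cases hω : ω ∈ A
        · simp only [indicator_of_mem hω, ← hr n]
          exact (hAp ω hω).2 (r n)
        · simp [hω]
      rw [this]
      exact (hX (r n)).measurable_mk.indicator hAm
    · exact tendsto_pi_nhds.2 fun ω => ((hcont ω).tendsto t).comp hq.2
  · filter_upwards [hA] with ω hω t
    simp [hω]

lemma HasBrownianVariogram.congr {W' : ℝ → Ω → ℝ} (hW : HasBrownianVariogram P W)
    (h : ∀ᵐ ω ∂P, ∀ t, W t ω = W' t ω) : HasBrownianVariogram P W' := by
  intro x y
  refine ⟨(hW x y).1.ae_eq ?_, ?_⟩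
  · filter_upwards [h] with ω hω
    rw [hω x, hω y]
  · rw [← (hW x y).2]
    refine integral_congr_ae ?_
    filter_upwards [h] with ω hω
    rw [hω x, hω y]

/-- Elementary integrals of step functions supported in `(-∞, t]` only use increments up to `t`. -/
lemma StepData.measurable_integral_pastIncrements {T : Type*} (D : StepData) {t : ℝ}
    (hD : ∀ i, D.b i ≤ t) (W : ℝ → T → ℝ) : Measurable[pastIncrements W t] (D.integral W) := by
  have h1 : ∀ i, Measurable[pastIncrements W t] fun ω => W (D.b i) ω - W (D.a i) ω := fun i =>
    (comap_measurable _).mono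
      (le_iSup₂_of_le (f := fun (u : Iic t) (v : Iic t) =>
        MeasurableSpace.comap (fun ω => W (v : ℝ) ω - W (u : ℝ) ω) inferInstance)
        ⟨D.a i, (D.le i).trans (hD i)⟩ ⟨D.b i, hD i⟩ le_rfl) le_rfl
  exact Finset.measurable_sum (m := pastIncrements W t) _ fun i _ =>
    Measurable.const_mul (h1 i) (D.c i)

/-- A continuous version of the Ornstein-Uhlenbeck process exists, and this version is a
non-anticipating solution of the equation. -/
theorem exists_isOrnsteinUhlenbeck [IsProbabilityMeasure P] (hW : IsTwoSidedBrownianMotion P W)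
    {α : ℝ} (hα : 0 < α) (σ : ℝ) :
    ∃ X : ℝ → Ω → ℝ, IsOrnsteinUhlenbeck P W α σ X ∧ IsSolution P W α σ X ∧
      IsNonanticipating P W X := by
  obtain ⟨W', hc, hm, hWW'⟩ := exists_continuous_modification hW.aemeasurable hW.continuous_paths
  have hV := (hasBrownianVariogram_of_isTwoSidedBrownianMotion hW).congr hWW'
  have hD : ∀ D : StepData, D.integral W =ᵐ[P] D.integral W' := fun D => by
    filter_upwards [hWW'] with ω hω
    simp only [StepData.integral, hω]
  have hpath : ∀ᵐ ω ∂P, Continuous (fun t => pastDeviation α W' t ω) ∧ ∀ a b : ℝ,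
      pastDeviation α W' b ω - pastDeviation α W' a ω
        = (∫ x in a..b, -α * pastDeviation α W' x ω) + (W' b ω - W' a ω) := by
    filter_upwards [hV.ae_integrable hm hα 0] with ω hω
    exact pastDeviation_equation hα (hc ω) hω
  have hcont : ∀ᵐ ω ∂P, Continuous fun t => Real.sqrt (2 * α) * σ * pastDeviation α W' t ω := by
    filter_upwards [hpath] with ω hω
    exact continuous_const.mul hω.1
  refine ⟨fun t ω => Real.sqrt (2 * α) * σ * pastDeviation α W' t ω, ⟨fun t => ?_, hcont⟩,
    ⟨fun t => ?_, hcont, ?_⟩, fun t => ?_⟩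
  · obtain ⟨hf, hI, D, -, hDf, hDI⟩ := exists_stepData_tendsto_pastDeviation hV hm hα t
    refine ⟨pastDeviation α W' t, ⟨hf, hI, D, hDf, hDI.congr fun n => eLpNorm_congr_ae ?_⟩,
      ae_of_all _ fun ω => rfl⟩
    filter_upwards [hD (D n)] with ω hω
    rw [hω]
  · exact (hV.memLp_pastDeviation hm hα t).1.aemeasurable.const_mul _
  · filter_upwards [hpath, hWW'] with ω hω hω' a b _
    rw [hω', hω', ← mul_sub, hω.2 a b, mul_add, ← intervalIntegral.integral_const_mul]
    congr 1
    exact intervalIntegral.integral_congr fun x _ => by ring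
  · obtain ⟨-, hI, D, hDt, -, hDI⟩ := exists_stepData_tendsto_pastDeviation hV hm hα t
    obtain ⟨ns, -, hae⟩ := (tendstoInMeasure_of_tendsto_eLpNorm (by simp)
      (fun n => (hV.memLp_integral (D n)).1) hI.1 hDI).exists_seq_tendsto_ae
    have hlim : StronglyMeasurable[pastIncrements W t]
        fun ω => limUnder atTop fun n => (D (ns n)).integral W ω :=
      @StronglyMeasurable.limUnder ℕ Ω ℝ (pastIncrements W t) _ _ atTop _ _ _ _ fun n =>
        ((D (ns n)).measurable_integral_pastIncrements (hDt _) W).stronglyMeasurable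
    refine ⟨fun ω => Real.sqrt (2 * α) * σ * limUnder atTop fun n => (D (ns n)).integral W ω,
      StronglyMeasurable.const_mul hlim _, ?_⟩
    filter_upwards [hae, ae_all_iff.2 fun n => hD (D (ns n))] with ω h1 h2
    simp only [h2, h1.limUnder_eq]

end AlmostAutomorphy

namespace AlmostAutomorphy

variable {Ω : Type*} [MeasurableSpace Ω] {P : Measure Ω} {W X V : ℝ → Ω → ℝ} {α σ : ℝ}

/-! ### Properties of the Ornstein-Uhlenbeck process -/

lemma indistinguishable_of_continuous (hX : ∀ᵐ ω ∂P, Continuous fun t => X t ω)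
    (hV : ∀ᵐ ω ∂P, Continuous fun t => V t ω) (h : ∀ t, X t =ᵐ[P] V t) :
    ∀ᵐ ω ∂P, ∀ t, X t ω = V t ω := by
  filter_upwards [hX, hV, ae_all_iff.2 fun q : ℚ => h q] with ω h1 h2 h3
  exact congrFun ((Rat.denseRange_cast (𝕜 := ℝ)).equalizer h1 h2 (funext h3))

lemma IsOrnsteinUhlenbeck.isWienerIntegral (hX : IsOrnsteinUhlenbeck P W α σ X) (t : ℝ) :
    IsWienerIntegral P W (fun s => Real.sqrt (2 * α) * σ *
      (Iic t).indicator (fun s => Real.exp (-α * (t - s))) s) (X t) := by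
  obtain ⟨I, hI, hXI⟩ := hX.integral t
  refine (hI.const_mul _).congr ?_
  filter_upwards [hXI] with ω hω using hω.symm

lemma IsOrnsteinUhlenbeck.indistinguishable (hW : IsTwoSidedBrownianMotion P W)
    (hX : IsOrnsteinUhlenbeck P W α σ X) (hV : IsOrnsteinUhlenbeck P W α σ V) :
    ∀ᵐ ω ∂P, ∀ t, X t ω = V t ω :=
  indistinguishable_of_continuous hX.continuous_paths hV.continuous_paths fun t =>
    (hX.isWienerIntegral t).ae_eq (hasBrownianVariogram_of_isTwoSidedBrownianMotion hW)
      (hV.isWienerIntegral t)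

lemma integral_kernel_mul_kernel (hα : 0 < α) {t τ : ℝ} (hτ : 0 ≤ τ) :
    ∫ s, (Iic t).indicator (fun s => Real.exp (-α * (t - s))) s *
      (Iic (t + τ)).indicator (fun s => Real.exp (-α * (t + τ - s))) s
      = Real.exp (-α * τ) / (2 * α) := by
  have h1 : ∀ s, (Iic t).indicator (fun s => Real.exp (-α * (t - s))) s *
      (Iic (t + τ)).indicator (fun s => Real.exp (-α * (t + τ - s))) s =
      (Iic t).indicator (fun s => Real.exp (-α * (2 * t + τ)) * Real.exp ((2 * α) * s)) s := by
    intro s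
    by_cases hs : s ≤ t
    · have hs' : s ≤ t + τ := by linarith
      simp only [indicator, mem_Iic, hs, hs', if_true, ← Real.exp_add]
      ring_nf
    · simp [hs]
  simp only [h1]
  rw [integral_indicator measurableSet_Iic, integral_const_mul,
    integral_exp_mul_Iic (by positivity), ← mul_div_assoc, ← Real.exp_add]
  ring_nf

lemma IsOrnsteinUhlenbeck.integral_mul [IsProbabilityMeasure P]
    (hW : IsTwoSidedBrownianMotion P W) (hα : 0 < α) (hX : IsOrnsteinUhlenbeck P W α σ X)
    (t : ℝ) {τ : ℝ} (hτ : 0 ≤ τ) :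
    ∫ ω, X t ω * X (t + τ) ω ∂P = σ ^ 2 * Real.exp (-α * τ) := by
  rw [(hX.isWienerIntegral t).integral_mul_eq (hasBrownianVariogram_of_isTwoSidedBrownianMotion hW)
    (hX.isWienerIntegral (t + τ))]
  have h1 : ∀ s, (Real.sqrt (2 * α) * σ * (Iic t).indicator (fun s => Real.exp (-α * (t - s))) s) *
      (Real.sqrt (2 * α) * σ *
        (Iic (t + τ)).indicator (fun s => Real.exp (-α * (t + τ - s))) s) =
      (2 * α * σ ^ 2) * ((Iic t).indicator (fun s => Real.exp (-α * (t - s))) s *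
      (Iic (t + τ)).indicator (fun s => Real.exp (-α * (t + τ - s))) s) := by
    intro s
    have : Real.sqrt (2 * α) * Real.sqrt (2 * α) = 2 * α := Real.mul_self_sqrt (by positivity)
    linear_combination (σ ^ 2 * ((Iic t).indicator (fun s => Real.exp (-α * (t - s))) s *
      (Iic (t + τ)).indicator (fun s => Real.exp (-α * (t + τ - s))) s)) * this
  simp only [h1]
  rw [integral_const_mul, integral_kernel_mul_kernel hα hτ]
  field_simp

lemma IsOrnsteinUhlenbeck.covariance_eq [IsProbabilityMeasure P]
    (hW : IsTwoSidedBrownianMotion P W) (hα : 0 < α) (hX : IsOrnsteinUhlenbeck P W α σ X)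
    (t : ℝ) {τ : ℝ} (hτ : 0 ≤ τ) :
    covariance (X t) (X (t + τ)) P = σ ^ 2 * Real.exp (-α * τ) := by
  rw [covariance_eq_sub (hX.isWienerIntegral t).2.1 (hX.isWienerIntegral (t + τ)).2.1,
    (hX.isWienerIntegral t).integral_eq_zero hW, zero_mul, sub_zero, ← hX.integral_mul hW hα t hτ]
  rfl

lemma IsOrnsteinUhlenbeck.integral_sq [IsProbabilityMeasure P]
    (hW : IsTwoSidedBrownianMotion P W) (hα : 0 < α) (hX : IsOrnsteinUhlenbeck P W α σ X)
    (t : ℝ) : ∫ ω, X t ω ^ 2 ∂P = σ ^ 2 := by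
  have := hX.integral_mul hW hα t le_rfl
  simpa [sq] using this

lemma IsOrnsteinUhlenbeck.isL2Bounded [IsProbabilityMeasure P]
    (hW : IsTwoSidedBrownianMotion P W) (hα : 0 < α) (hX : IsOrnsteinUhlenbeck P W α σ X) :
    IsL2Bounded P X := by
  refine ⟨(√(σ ^ 2)).toNNReal, fun t => ⟨(hX.isWienerIntegral t).2.1, ?_⟩⟩
  rw [eLpNorm_two_eq_ofReal (hX.isWienerIntegral t).2.1, hX.integral_sq hW hα]
  rfl

/-- Values of the process at times with distance at least `1` are uniformly separated in mean
square, because their covariance stays away from the variance. -/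
lemma IsOrnsteinUhlenbeck.le_norm_sub [IsProbabilityMeasure P]
    (hW : IsTwoSidedBrownianMotion P W) (hα : 0 < α) (hX : IsOrnsteinUhlenbeck P W α σ X)
    (hL : ∀ t, MemLp (X t) 2 P) {a b : ℝ} (hab : 1 ≤ |a - b|) :
    √(2 * σ ^ 2 * (1 - Real.exp (-α))) ≤ ‖(hL a).toLp (X a) - (hL b).toLp (X b)‖ := by
  wlog h : a ≤ b generalizing a b
  · rw [norm_sub_rev]
    exact this (by rwa [abs_sub_comm]) (le_of_not_ge h)
  obtain ⟨τ, rfl⟩ : ∃ τ, b = a + τ := ⟨b - a, by ring⟩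
  have hτ : 0 ≤ τ := by linarith
  have hτ1 : 1 ≤ τ := by simpa [abs_of_nonneg hτ] using hab
  have h1 : ∫ ω, (X a ω - X (a + τ) ω) ^ 2 ∂P = 2 * σ ^ 2 * (1 - Real.exp (-α * τ)) := by
    have h2 := integral_add_sq (hL a) (hL (a + τ)).neg
    simp only [Pi.neg_apply, ← sub_eq_add_neg, neg_sq, mul_neg, integral_neg] at h2
    rw [h2, hX.integral_sq hW hα, hX.integral_sq hW hα, hX.integral_mul hW hα a hτ]
    ring
  rw [← MemLp.toLp_sub, Lp.norm_toLp, eLpNorm_two_eq_ofReal ((hL a).sub (hL (a + τ))),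
    ENNReal.toReal_ofReal (Real.sqrt_nonneg _)]
  simp only [Pi.sub_apply]
  rw [h1]
  gcongr
  nlinarith

/-! ### Uniqueness of `L²`-bounded solutions -/

/-- A path which satisfies `D(t) - D(s) = -α ∫_s^t D` is an exponential function, also backwards in
time. -/
lemma eq_exp_mul_of_integral_equation {D : ℝ → ℝ} (hD : Continuous D)
    (h : ∀ s t, s ≤ t → D t - D s = ∫ u in s..t, -α * D u) (s t : ℝ) :
    D t = Real.exp (-α * (t - s)) * D s := by
  have hder : ∀ x, HasDerivAt D (-α * D x) x := by
    intro x
    have hc : Continuous fun u => -α * D u := by fun_prop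
    have h1 : HasDerivAt (fun y => D (x - 1) + ∫ u in (x - 1)..y, -α * D u) (-α * D x) x :=
      (intervalIntegral.integral_hasDerivAt_right (hc.intervalIntegrable _ _)
        hc.aestronglyMeasurable.stronglyMeasurableAtFilter hc.continuousAt).const_add _
    refine h1.congr_of_eventuallyEq ?_
    filter_upwards [eventually_gt_nhds (show x - 1 < x by linarith)] with y hy
    rw [← h _ _ hy.le]
    ring
  have hE : ∀ x, HasDerivAt (fun x => Real.exp (α * x) * D x) 0 x := by
    intro x
    have h1 : HasDerivAt (fun x => α * x) α x := by simpa using (hasDerivAt_id x).const_mul α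
    refine (h1.exp.mul (hder x)).congr_deriv ?_
    ring
  have hconst := is_const_of_deriv_eq_zero (fun x => (hE x).differentiableAt)
    (fun x => (hE x).deriv) t s
  have h2 : Real.exp (-α * t) * Real.exp (α * t) = 1 := by rw [← Real.exp_add]; simp
  have h3 : Real.exp (-α * (t - s)) = Real.exp (-α * t) * Real.exp (α * s) := by
    rw [← Real.exp_add]; ring_nf
  rw [h3]
  linear_combination Real.exp (-α * t) * hconst - D t * h2

/-- The difference of two `L²`-bounded solutions decays exponentially, hence vanishes as it has been
decaying from a bounded size since time `-∞`. -/
theorem IsSolution.indistinguishable_of_isL2Bounded (hα : 0 < α) (hX : IsSolution P W α σ X)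
    (hV : IsSolution P W α σ V) (hXb : IsL2Bounded P X) (hVb : IsL2Bounded P V) :
    ∀ᵐ ω ∂P, ∀ t, V t ω = X t ω := by
  have hD : ∀ᵐ ω ∂P, ∀ s t,
      V t ω - X t ω = Real.exp (-α * (t - s)) * (V s ω - X s ω) := by
    filter_upwards [hX.continuous_paths, hV.continuous_paths, hX.equation, hV.equation] with
      ω h1 h2 h3 h4
    refine eq_exp_mul_of_integral_equation (D := fun t => V t ω - X t ω) (h2.sub h1)
      fun s t hst => ?_
    have h5 : Continuous fun u => -α * V u ω := continuous_const.mul h2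
    have h6 : Continuous fun u => -α * X u ω := continuous_const.mul h1
    have h7 := intervalIntegral.integral_sub (h5.intervalIntegrable (μ := volume) s t)
      (h6.intervalIntegrable s t)
    simp only [mul_sub]
    rw [h7]
    linarith [h3 s t hst, h4 s t hst]
  obtain ⟨C, hC⟩ := hXb
  obtain ⟨C', hC'⟩ := hVb
  have h0 : ∀ t, eLpNorm (fun ω => V t ω - X t ω) 2 P = 0 := by
    intro t
    have hle : ∀ n : ℕ, eLpNorm (fun ω => V t ω - X t ω) 2 P
        ≤ ENNReal.ofReal (Real.exp (-α * n)) * (C' + C) := by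
      intro n
      have h1 : (fun ω => V t ω - X t ω) =ᵐ[P]
          Real.exp (-α * n) • (V (t - n) - X (t - n)) := by
        filter_upwards [hD] with ω hω
        rw [hω (t - n) t]
        simp
      rw [eLpNorm_congr_ae h1, eLpNorm_const_smul, Real.enorm_of_nonneg (Real.exp_nonneg _)]
      gcongr
      exact (eLpNorm_sub_le (hC' _).1.1 (hC _).1.1 (by simp)).trans
        (add_le_add (hC' _).2 (hC _).2)
    have hlim : Tendsto (fun n : ℕ => ENNReal.ofReal (Real.exp (-α * n)) * ((C' : ℝ≥0∞) + C))
        atTop (𝓝 0) := by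
      have h1 : Tendsto (fun n : ℕ => -α * (n : ℝ)) atTop atBot :=
        tendsto_natCast_atTop_atTop.const_mul_atTop_of_neg (by linarith)
      have h2 := ENNReal.tendsto_ofReal (Real.tendsto_exp_atBot.comp h1)
      have h3 := ENNReal.Tendsto.mul_const (b := ((C' : ℝ≥0∞) + C)) h2 (Or.inr (by simp))
      simpa using h3
    exact le_antisymm (ge_of_tendsto' hlim hle) zero_le
  refine indistinguishable_of_continuous hV.continuous_paths hX.continuous_paths fun t => ?_
  have h1 := (eLpNorm_eq_zero_iff (f := fun ω => V t ω - X t ω)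
    ((hC' t).1.1.sub (hC t).1.1) (by simp)).1 (h0 t)
  filter_upwards [h1] with ω hω
  simpa [sub_eq_zero] using hω

lemma IsSolution.congr (hX : IsSolution P W α σ X) (h : ∀ᵐ ω ∂P, ∀ t, X t ω = V t ω) :
    IsSolution P W α σ V where
  aemeasurable t := (hX.aemeasurable t).congr (by filter_upwards [h] with ω hω using hω t)
  continuous_paths := by
    filter_upwards [hX.continuous_paths, h] with ω h1 h2
    simpa only [h2] using h1
  equation := by
    filter_upwards [hX.equation, h] with ω h1 h2
    simpa only [h2] using h1

lemma IsOrnsteinUhlenbeck.congr (hX : IsOrnsteinUhlenbeck P W α σ X)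
    (h : ∀ᵐ ω ∂P, ∀ t, X t ω = V t ω) : IsOrnsteinUhlenbeck P W α σ V where
  integral t := by
    obtain ⟨I, hI, hXI⟩ := hX.integral t
    refine ⟨I, hI, ?_⟩
    filter_upwards [hXI, h] with ω h1 h2
    rw [← h2, h1]
  continuous_paths := by
    filter_upwards [hX.continuous_paths, h] with ω h1 h2
    simpa only [h2] using h1

lemma isL2Bounded_of_norm_toLp_le (hL : ∀ t, MemLp (X t) 2 P) {C : ℝ}
    (hC : ∀ t, ‖(hL t).toLp (X t)‖ ≤ C) : IsL2Bounded P X := by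
  refine ⟨C.toNNReal, fun t => ⟨hL t, ?_⟩⟩
  have h1 := hC t
  rw [Lp.norm_toLp] at h1
  exact (ENNReal.le_ofReal_iff_toReal_le (hL t).2.ne (ENNReal.toReal_nonneg.trans h1)).2 h1

end AlmostAutomorphy

theorem mainTheorem3 {Ω : Type*} [MeasurableSpace Ω] (P : Measure Ω) [IsProbabilityMeasure P]
    (W : ℝ → Ω → ℝ) (hW : AlmostAutomorphy.IsTwoSidedBrownianMotion P W)
    (α σ : ℝ) (hα : 0 < α) (hσ : 0 < σ) :
    -- the Ornstein-Uhlenbeck process exists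
    (∃ X : ℝ → Ω → ℝ, AlmostAutomorphy.IsOrnsteinUhlenbeck P W α σ X) ∧
    (∀ X : ℝ → Ω → ℝ, AlmostAutomorphy.IsOrnsteinUhlenbeck P W α σ X →
      -- it is a centred Gaussian process with covariance `σ² exp (-α τ)`
      (IsGaussianProcess X P ∧ (∀ t : ℝ, ∫ ω, X t ω ∂P = 0) ∧
        ∀ t τ : ℝ, 0 ≤ τ →
          covariance (X t) (X (t + τ)) P = σ ^ 2 * Real.exp (-α * τ)) ∧
      -- it is the unique `L²`-bounded solution
      (AlmostAutomorphy.IsSolution P W α σ X ∧ AlmostAutomorphy.IsNonanticipating P W X ∧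
        AlmostAutomorphy.IsL2Bounded P X ∧
        ∀ V : ℝ → Ω → ℝ, AlmostAutomorphy.IsSolution P W α σ V →
          AlmostAutomorphy.IsL2Bounded P V → ∀ᵐ ω ∂P, ∀ t : ℝ, V t ω = X t ω) ∧
      -- it is not square-mean `μ`-pseudo almost automorphic
      (∀ μ : Measure ℝ, AlmostAutomorphy.IsAdmissibleWeight μ →
        AlmostAutomorphy.HasPositiveRightWeight μ →
        ¬ AlmostAutomorphy.InSquareMean P
          (AlmostAutomorphy.IsPseudoAlmostAutomorphic μ) X) ∧
      -- nor in the Besicovitch-like or in the Weyl-like sense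
      (∀ μ : Measure ℝ, AlmostAutomorphy.IsAdmissibleWeight μ →
        ¬ AlmostAutomorphy.InSquareMean P (AlmostAutomorphy.IsBesicovitchPAA 2 μ) X ∧
        ¬ AlmostAutomorphy.InSquareMean P (AlmostAutomorphy.IsWeylPAA 2 μ) X) ∧
      -- nor in the Stepanov-like sense, whatever the weight `ν`
      (∀ μ : Measure ℝ, AlmostAutomorphy.IsAdmissibleWeight μ →
        AlmostAutomorphy.HasPositiveRightWeight μ →
        ∀ ν : Measure (Icc (0 : ℝ) 1), 0 < ν univ → ν univ < ∞ →
        ¬ AlmostAutomorphy.InSquareMean P (AlmostAutomorphy.IsStepanovPAA 2 ν μ) X)) ∧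
    -- the equation has no square-mean (`μ`-pseudo) almost automorphic solution at all
    (∀ V : ℝ → Ω → ℝ, AlmostAutomorphy.IsSolution P W α σ V →
      ¬ AlmostAutomorphy.InSquareMean P AlmostAutomorphy.IsAlmostAutomorphic V ∧
      ∀ μ : Measure ℝ, AlmostAutomorphy.IsAdmissibleWeight μ →
        AlmostAutomorphy.HasPositiveRightWeight μ →
        ¬ AlmostAutomorphy.InSquareMean P
          (AlmostAutomorphy.IsPseudoAlmostAutomorphic μ) V) := by
  open AlmostAutomorphy in
  obtain ⟨Y, hY, hYs, hYn⟩ := exists_isOrnsteinUhlenbeck hW hα σ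
  have hδ : 0 < √(2 * σ ^ 2 * (1 - Real.exp (-α))) := by
    have : Real.exp (-α) < 1 := Real.exp_lt_one_iff.2 (by linarith)
    exact Real.sqrt_pos.2 (mul_pos (by positivity) (by linarith))
  have hPAA : ∀ X, IsOrnsteinUhlenbeck P W α σ X → ∀ μ, IsAdmissibleWeight μ →
      ¬ InSquareMean P (IsPseudoAlmostAutomorphic μ) X := by
    rintro X hX μ hμ ⟨hL, hQ⟩
    exact not_isPseudoAlmostAutomorphic_of_separated hμ hδ
      (fun a b hab => hX.le_norm_sub hW hα hL hab) hQ
  refine ⟨⟨Y, hY⟩, fun X hX => ?_, fun V hV => ?_⟩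
  · -- The solution property and non-anticipation are known for the constructed version `Y`, and are
    -- inherited by `X`, which is indistinguishable from it.
    have hYX := hY.indistinguishable hW hX
    have hXs := hYs.congr hYX
    refine ⟨⟨isGaussianProcess_of_isWienerIntegral hW hX.isWienerIntegral,
      fun t => (hX.isWienerIntegral t).integral_eq_zero hW,
      fun t τ hτ => hX.covariance_eq hW hα t hτ⟩,
      ⟨hXs, fun t => (hYn t).congr (hYX.mono fun ω hω => hω t), hX.isL2Bounded hW hα,
        fun V hV hVb => hXs.indistinguishable_of_isL2Bounded hα hV (hX.isL2Bounded hW hα) hVb⟩,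
      fun μ hμ _ => hPAA X hX μ hμ, fun μ hμ => ⟨?_, ?_⟩, fun μ hμ _ ν hν _ => ?_⟩
    · rintro ⟨hL, hQ⟩
      exact not_isBesicovitchPAA_of_separated hμ hδ
        (fun a b hab => hX.le_norm_sub hW hα hL hab) hQ
    · rintro ⟨hL, hQ⟩
      exact not_isWeylPAA_of_separated hμ hδ (fun a b hab => hX.le_norm_sub hW hα hL hab) hQ
    · rintro ⟨hL, hQ⟩
      exact not_isStepanovPAA_of_separated hμ hν hδ
        (fun a b hab => hX.le_norm_sub hW hα hL hab) hQ
  · have key : ∀ μ, IsAdmissibleWeight μ → ¬ InSquareMean P (IsPseudoAlmostAutomorphic μ) V := by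
      rintro μ hμ ⟨hL, hQ⟩
      obtain ⟨C, hC⟩ := hQ.exists_norm_le
      -- A pseudo almost automorphic solution is bounded, so it is the Ornstein-Uhlenbeck process.
      have hVY := hYs.indistinguishable_of_isL2Bounded hα hV (hY.isL2Bounded hW hα)
        (isL2Bounded_of_norm_toLp_le hL hC)
      exact hPAA V (hY.congr (hVY.mono fun ω hω t => (hω t).symm)) μ hμ ⟨hL, hQ⟩
    refine ⟨?_, fun μ hμ _ => key μ hμ⟩
    rintro ⟨hL, hQ⟩
    exact key volume isAdmissibleWeight_volume ⟨hL, hQ.isPseudoAlmostAutomorphic volume⟩
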